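/- Let $k$ be an algebraically closed field of characteristic $0$, let $N$ be a free abelian group of finite rank, $M=\operatorname{Hom}(N,\mathbb Z)$, and for a lattice $N'$ write $\mathbb G(N')=\operatorname{Spec} k[\operatorname{Hom}(N',\mathbb Z)]$, with closed points $\operatorname{Hom}(\operatorname{Hom}(N',\mathbb Z),k^\times)$. Let $\Sigma$ be a fan in $N_{\mathbb Q}$ and $X=X(\Sigma)$ the associated toric variety over $k$, with big torus $\mathbb G(N)$ and toric boundary $D=X\setminus\mathbb G(N)$. A *line* on $X$ is a non-constant morphism $\varphi:\mathbb P^1\to X$ which is torically transverse (the preimage of the big torus is dense, and the image is disjoint from all toric strata of codimension $>1$) and satisfies $\sharp\varphi^{-1}(D)\le 3$. Let $a\in\{2,3\}$, let $u_1,\dots,u_a\in N$ be primitive vectors such that the rays $\mathbb Q_{\ge0}u_i$ belong to $\Sigma$, with corresponding toric prime divisors $D_{u_i}\subset X$, and let $w_1,\dots,w_a$ be positive integers with $\sum_i w_iu_i=0$. A line $\varphi$ is *of type* $(\mathbf u,\mathbf w)$ if $\varphi^{-1}(D)$ consists of $a$ distinct points $p_1,\dots,p_a$ such that, at $p_i$,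 $\varphi$ meets $D_{u_i}$ with intersection multiplicity $w_i$. Let $\mathfrak L_{(\mathbf u,\mathbf w)}$ be the space of lines of type $(\mathbf u,\mathbf w)$, that is, the set of such lines modulo automorphisms of $\mathbb P^1$. The torus $\mathbb G(N)$ acts on it by composition with its action on $X$. Then, on closed points: 1. $\mathfrak L_{(\mathbf u,\mathbf w)}$ is non-empty and $\mathbb G(N)$ acts transitively on it. 2. In the trivalent case $a=3$ this action is simply transitive. 3. In the divalent case $a=2$ one has $\mathbb Zu_1=\mathbb Zu_2$, and the action of $\mathbb G(N)$ factors, through the canonical homomorphism $\mathbb G(N)\to\mathbb G(N/\mathbb Zu_1)=\mathbb G(N/\mathbb Zu_2)$, over a simply transitive action of $\mathbb G(N/\mathbb Zu_1)$ on $\mathfrak L_{(\mathbf u,\mathbf w)}$. -/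

import Mathlib

open scoped TensorProduct LinearAlgebra.Projectivization

noncomputable section

namespace ToricLines

/-! ### Lattices, cones and fans -/

section Cones

variable {N : Type*} [AddCommGroup N]

/-- The rational vector space `N_ℚ = ℚ ⊗ N`. -/
abbrev NQ (N : Type*) [AddCommGroup N] : Type _ := ℚ ⊗[ℤ] N

/-- The pairing `⟨m, ·⟩ : N_ℚ → ℚ` for `m ∈ M = Hom(N, ℤ)`. -/
def pairing (m : Module.Dual ℤ N) : NQ N →ₗ[ℚ] ℚ :=
  Module.Dual.baseChange ℚ m

/-- The monoid `σ^∨ ∩ M`. -/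
def dualMonoid (σ : PointedCone ℚ (NQ N)) : AddSubmonoid (Module.Dual ℤ N) where
  carrier := {m | ∀ v ∈ σ, 0 ≤ pairing m v}
  zero_mem' := by intro v _; simp [pairing]
  add_mem' := by
    intro a b ha hb v hv
    have h : pairing (a + b) v = pairing a v + pairing b v := by
      simp [pairing]
    rw [h]
    exact add_nonneg (ha v hv) (hb v hv)

lemma dualMonoid_anti {σ τ : PointedCone ℚ (NQ N)} (h : τ ≤ σ) :
    dualMonoid σ ≤ dualMonoid τ :=
  fun _ hm v hv => hm v (h hv)

/-- `τ` is a face of `σ`: it is cut out of `σ` by the hyperplane `m^⊥` for some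
`m ∈ σ^∨ ∩ M`. -/
def IsFace (τ σ : PointedCone ℚ (NQ N)) : Prop :=
  ∃ m ∈ dualMonoid σ, ∀ v, v ∈ τ ↔ v ∈ σ ∧ pairing m v = 0

/-- The dimension of a cone, that is, of its linear span. -/
def coneDim (σ : PointedCone ℚ (NQ N)) : ℕ :=
  Module.finrank ℚ (Submodule.span ℚ (σ : Set (NQ N)))

/-- The ray `ℚ_{≥0} u`. -/
def ray (u : N) : PointedCone ℚ (NQ N) := PointedCone.hull ℚ {(1 : ℚ) ⊗ₜ[ℤ] u}

/-- `u ∈ N` is primitive: it is not a proper integral multiple (in particular `u ≠ 0`). -/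
def IsPrimitive (u : N) : Prop := ∀ (d : ℤ) (v : N), u = d • v → IsUnit d

end Cones

/-- A fan in `N_ℚ`: a finite nonempty set of strongly convex polyhedral cones, closed under
taking faces, any two of which intersect in a common face. (For such a set, being nonempty
is the same as containing the cone `0`.) -/
structure Fan (N : Type*) [AddCommGroup N] where
  cones : Set (PointedCone ℚ (NQ N))
  finite : cones.Finite
  zero_mem : ⊥ ∈ cones
  polyhedral : ∀ σ ∈ cones, σ.FG
  stronglyConvex : ∀ σ ∈ cones, ∀ v ∈ σ, -v ∈ σ → v = 0
  face_mem : ∀ σ ∈ cones, ∀ τ, IsFace τ σ → τ ∈ cones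
  inter_face_left : ∀ σ ∈ cones, ∀ τ ∈ cones, IsFace (σ ⊓ τ) σ
  inter_face_right : ∀ σ ∈ cones, ∀ τ ∈ cones, IsFace (σ ⊓ τ) τ

/-! ### The torus and the toric variety

Varieties over the algebraically closed field `k` are treated classically: through their sets
of closed (that is, `k`-valued) points and their regular functions. -/

section Toric

variable (k : Type*) [Field k] {N : Type*} [AddCommGroup N]

/-- The closed points of the torus `𝔾(N) = Spec k[M]`: the homomorphisms `M → kˣ`. -/
def Torus (N : Type*) [AddCommGroup N] : Type _ :=
  Multiplicative (Module.Dual ℤ N) →* kˣ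

instance : CommGroup (Torus k N) :=
  inferInstanceAs (CommGroup (Multiplicative (Module.Dual ℤ N) →* kˣ))

instance : FunLike (Torus k N) (Multiplicative (Module.Dual ℤ N)) kˣ :=
  inferInstanceAs (FunLike (Multiplicative (Module.Dual ℤ N) →* kˣ) _ _)

instance : MonoidHomClass (Torus k N) (Multiplicative (Module.Dual ℤ N)) kˣ :=
  inferInstanceAs (MonoidHomClass (Multiplicative (Module.Dual ℤ N) →* kˣ) _ _)

variable {k} in
@[simp] lemma Torus.one_apply (m : Multiplicative (Module.Dual ℤ N)) :
    (1 : Torus k N) m = 1 := rfl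

variable {k} in
@[simp] lemma Torus.mul_apply (g h : Torus k N) (m : Multiplicative (Module.Dual ℤ N)) :
    (g * h) m = g m * h m := rfl

/-- The homomorphism of tori `𝔾(N) → 𝔾(N')` induced by a homomorphism `N → N'`. -/
def Torus.map {N' : Type*} [AddCommGroup N'] (f : N →ₗ[ℤ] N') : Torus k N →* Torus k N' where
  toFun g := MonoidHom.comp (M := Multiplicative (Module.Dual ℤ N')) (P := kˣ) g
    (AddMonoidHom.toMultiplicative f.dualMap.toAddMonoidHom)
  map_one' := rfl
  map_mul' _ _ := rfl

/-- The coordinate ring `k[σ^∨ ∩ M]` of the affine toric variety of `σ`. -/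
abbrev CoordRing (σ : PointedCone ℚ (NQ N)) : Type _ := AddMonoidAlgebra k (dualMonoid σ)

/-- The closed points of `Spec k[σ^∨ ∩ M]`. -/
abbrev AffinePoint (σ : PointedCone ℚ (NQ N)) : Type _ := CoordRing k σ →ₐ[k] k

variable {k}

/-- The monomial `χ^m ∈ k[σ^∨ ∩ M]`. -/
def chi {σ : PointedCone ℚ (NQ N)} (m : dualMonoid σ) : CoordRing k σ :=
  AddMonoidAlgebra.single m 1

/-- The inclusion `k[σ^∨ ∩ M] ⊆ k[τ^∨ ∩ M]` for `τ ⊆ σ`. -/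
def coordIncl {σ τ : PointedCone ℚ (NQ N)} (h : τ ≤ σ) : CoordRing k σ →ₐ[k] CoordRing k τ :=
  AddMonoidAlgebra.mapDomainAlgHom k k (AddSubmonoid.inclusion (dualMonoid_anti h))

/-- The map `Spec k[τ^∨ ∩ M] → Spec k[σ^∨ ∩ M]` for `τ ⊆ σ`. -/
def AffinePoint.incl {σ τ : PointedCone ℚ (NQ N)} (h : τ ≤ σ) (x : AffinePoint k τ) :
    AffinePoint k σ :=
  x.comp (coordIncl h)

/-- Twisting `k[σ^∨ ∩ M]` by a point of the torus: `χ^m ↦ g(m) χ^m`. -/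
def twist (σ : PointedCone ℚ (NQ N)) (g : Torus k N) : CoordRing k σ →ₐ[k] CoordRing k σ :=
  AddMonoidAlgebra.lift k (CoordRing k σ) (dualMonoid σ)
    { toFun := fun m => (g (Multiplicative.ofAdd (m.toAdd : Module.Dual ℤ N)) : k) • chi m.toAdd
      map_one' := by
        simp only [toAdd_one, ZeroMemClass.coe_zero, ofAdd_zero, map_one, Units.val_one, one_smul]
        rfl
      map_mul' := fun a b => by
        simp [chi, AddMonoidAlgebra.single_mul_single] }

@[simp] lemma twist_chi (σ : PointedCone ℚ (NQ N)) (g : Torus k N) (m : dualMonoid σ) :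
    twist σ g (chi m) = (g (Multiplicative.ofAdd (m : Module.Dual ℤ N)) : k) • chi m := by
  simp [twist, chi, AddMonoidAlgebra.lift_single]

lemma coordRing_hom_ext {σ : PointedCone ℚ (NQ N)} {A : Type*} [Semiring A] [Algebra k A]
    {f g : CoordRing k σ →ₐ[k] A} (h : ∀ m, f (chi m) = g (chi m)) : f = g := by
  refine AddMonoidAlgebra.algHom_ext' ?_ ?_
  · ext m
    exact h m
  · ext

/-- The action of the torus on the points of `Spec k[σ^∨ ∩ M]`; on monomials
`χ^m (g • x) = g(m) χ^m(x)`. -/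
instance (σ : PointedCone ℚ (NQ N)) : MulAction (Torus k N) (AffinePoint k σ) where
  smul g x := x.comp (twist σ g)
  one_smul x := by
    refine coordRing_hom_ext fun m => ?_
    change x (twist σ 1 (chi m)) = _
    simp
  mul_smul g h x := by
    refine coordRing_hom_ext fun m => ?_
    change x (twist σ (g * h) (chi m)) = x (twist σ h (twist σ g (chi m)))
    simp [mul_assoc]

lemma smul_affine_apply {σ : PointedCone ℚ (NQ N)} (g : Torus k N) (x : AffinePoint k σ)
    (f : CoordRing k σ) : (g • x) f = x (twist σ g f) := rfl

lemma smul_affine_chi {σ : PointedCone ℚ (NQ N)} (g : Torus k N) (x : AffinePoint k σ)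
    (m : dualMonoid σ) :
    (g • x) (chi m) = (g (Multiplicative.ofAdd (m : Module.Dual ℤ N)) : k) * x (chi m) := by
  simp [smul_affine_apply]

lemma incl_smul {σ τ : PointedCone ℚ (NQ N)} (h : τ ≤ σ) (g : Torus k N) (x : AffinePoint k τ) :
    AffinePoint.incl h (g • x) = g • AffinePoint.incl h x := by
  refine coordRing_hom_ext fun m => ?_
  have hc : (coordIncl h (chi m) : CoordRing k τ)
      = chi (AddSubmonoid.inclusion (dualMonoid_anti h) m) := by
    simp [coordIncl, chi]
  change (g • x) (coordIncl h (chi m)) = x (coordIncl h (twist σ g (chi m)))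
  rw [twist_chi, map_smul, map_smul, hc, smul_affine_chi]
  rfl

variable (k) in
/-- Gluing of the affine pieces: `x ∈ U_σ` and `y ∈ U_τ` are identified if they are the images
of the same point of `U_{σ ∩ τ}`. -/
def GlueRel (F : Fan N) (a b : (σ : F.cones) × AffinePoint k (σ : PointedCone ℚ (NQ N))) :
    Prop :=
  ∃ z : AffinePoint k ((a.1 : PointedCone ℚ (NQ N)) ⊓ b.1),
    a.2 = z.incl inf_le_left ∧ b.2 = z.incl inf_le_right

variable (k) in
/-- The (closed points of the) toric variety `X(Σ)`: the affine varieties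
`U_σ = Spec k[σ^∨ ∩ M]`, `σ ∈ Σ`, glued along the `U_{σ ∩ τ}`. -/
def ToricVariety (F : Fan N) : Type _ := Quot (GlueRel k F)

variable {F : Fan N}

/-- The inclusion `U_σ → X(Σ)`. -/
def chart (σ : F.cones) (x : AffinePoint k (σ : PointedCone ℚ (NQ N))) : ToricVariety k F :=
  Quot.mk _ ⟨σ, x⟩

/-- The action of the big torus on `X(Σ)`. -/
instance : MulAction (Torus k N) (ToricVariety k F) where
  smul g := Quot.map (fun a => ⟨a.1, g • a.2⟩) (by
    rintro ⟨σ, x⟩ ⟨τ, y⟩ ⟨z, hx, hy⟩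
    refine ⟨g • z, ?_, ?_⟩
    · simp only [incl_smul]; exact congrArg (g • ·) hx
    · simp only [incl_smul]; exact congrArg (g • ·) hy)
  one_smul := by
    rintro ⟨σ, x⟩
    change chart σ ((1 : Torus k N) • x) = chart σ x
    rw [one_smul]
  mul_smul g h := by
    rintro ⟨σ, x⟩
    change chart σ ((g * h) • x) = chart σ (g • h • x)
    rw [mul_smul]

lemma smul_chart (σ : F.cones) (g : Torus k N) (x : AffinePoint k (σ : PointedCone ℚ (NQ N))) :
    g • chart σ x = chart σ (g • x) := rfl

variable (k F) in
/-- The torus orbit `O_σ = Int X_σ ⊆ U_σ` of a cone `σ ∈ Σ`: the monomials `χ^m` that do not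
vanish are those with `m ∈ σ^⊥`. -/
def orbit (σ : F.cones) : Set (ToricVariety k F) :=
  {x | ∃ y : AffinePoint k (σ : PointedCone ℚ (NQ N)), x = chart σ y ∧
    ∀ m, y (chi m) ≠ 0 ↔ ∀ v ∈ (σ : PointedCone ℚ (NQ N)), pairing (m : Module.Dual ℤ N) v = 0}

variable (k F) in
/-- The toric stratum `X_σ`, the closure of `O_σ`: the union of the orbits `O_τ`, `τ ⊇ σ`.
Its codimension is `dim σ`; for a ray `σ` it is a toric prime divisor. -/
def stratum (σ : F.cones) : Set (ToricVariety k F) :=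
  {x | ∃ τ : F.cones, (σ : PointedCone ℚ (NQ N)) ≤ τ ∧ x ∈ orbit k F τ}

variable (k F) in
/-- The big torus `Int X(Σ)`. -/
def bigTorus : Set (ToricVariety k F) := orbit k F ⟨⊥, F.zero_mem⟩

variable (k F) in
/-- The toric boundary, the complement of the big torus. -/
def boundary : Set (ToricVariety k F) := (bigTorus k F)ᶜ

lemma smul_mem_orbit {σ : F.cones} (g : Torus k N) {x : ToricVariety k F}
    (hx : x ∈ orbit k F σ) : g • x ∈ orbit k F σ := by
  obtain ⟨y, rfl, hy⟩ := hx
  refine ⟨g • y, rfl, fun m => ?_⟩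
  rw [smul_affine_chi, ← hy m]
  simp

lemma smul_mem_orbit_iff {σ : F.cones} (g : Torus k N) {x : ToricVariety k F} :
    g • x ∈ orbit k F σ ↔ x ∈ orbit k F σ :=
  ⟨fun h => by simpa using smul_mem_orbit g⁻¹ h, smul_mem_orbit g⟩

end Toric

/-! ### Regular functions and automorphisms of the projective line -/

section P1

variable (k : Type*) [Field k]

/-- The closed points of the projective line. -/
abbrev P1 : Type _ := ℙ k (Fin 2 → k)

variable {k}

/-- The value of a form at (a representative of) a point of the projective line. Only its
vanishing, and quotients of values of forms of the same degree, have a meaning. -/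
def formVal (f : MvPolynomial (Fin 2) k) (p : P1 k) : k := MvPolynomial.eval p.rep f

/-- Zariski open subsets of the projective line. -/
def IsZariskiOpen (V : Set (P1 k)) : Prop :=
  ∀ p ∈ V, ∃ (d : ℕ) (h : MvPolynomial (Fin 2) k), h.IsHomogeneous d ∧ formVal h p ≠ 0 ∧
    ∀ q, formVal h q ≠ 0 → q ∈ V

/-- The function `f` is regular on `V`: near every point of `V` it is a quotient of two forms
of the same degree. -/
def IsRegularOn (V : Set (P1 k)) (f : P1 k → k) : Prop :=
  ∀ p ∈ V, ∃ (d : ℕ) (a b : MvPolynomial (Fin 2) k), a.IsHomogeneous d ∧ b.IsHomogeneous d ∧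
    formVal b p ≠ 0 ∧ ∀ q ∈ V, formVal b q ≠ 0 → f q = formVal a q / formVal b q

/-- The function `f` vanishes to order exactly `w` at `p`: near `p` it is the `w`-th power of a
linear form with zero `p` times a nowhere vanishing quotient of forms. -/
def HasOrderAt (f : P1 k → k) (p : P1 k) (w : ℕ) : Prop :=
  ∃ (d : ℕ) (l a b : MvPolynomial (Fin 2) k), l.IsHomogeneous 1 ∧ l ≠ 0 ∧ formVal l p = 0 ∧
    a.IsHomogeneous d ∧ b.IsHomogeneous (d + w) ∧ formVal a p ≠ 0 ∧ formVal b p ≠ 0 ∧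
    ∀ q, formVal b q ≠ 0 → f q = formVal l q ^ w * formVal a q / formVal b q

/-- Morphisms of varieties from the projective line to itself. -/
def IsP1Morphism (α : P1 k → P1 k) : Prop :=
  ∀ V : Set (P1 k), IsZariskiOpen V →
    IsZariskiOpen (α ⁻¹' V) ∧ ∀ f, IsRegularOn V f → IsRegularOn (α ⁻¹' V) (f ∘ α)

/-- Automorphisms of the projective line. -/
def IsP1Automorphism (α : Equiv.Perm (P1 k)) : Prop :=
  IsP1Morphism α ∧ IsP1Morphism α.symm

lemma isP1Automorphism_refl : IsP1Automorphism (Equiv.refl (P1 k)) :=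
  ⟨fun _ hV => ⟨hV, fun _ hf => hf⟩, fun _ hV => ⟨hV, fun _ hf => hf⟩⟩

lemma IsP1Automorphism.symm {α : Equiv.Perm (P1 k)} (h : IsP1Automorphism α) :
    IsP1Automorphism α.symm := ⟨h.2, h.1⟩

lemma IsP1Morphism.comp {α β : P1 k → P1 k} (hα : IsP1Morphism α) (hβ : IsP1Morphism β) :
    IsP1Morphism (β ∘ α) := fun V hV =>
  ⟨(hα _ (hβ V hV).1).1, fun f hf => (hα _ (hβ V hV).1).2 _ ((hβ V hV).2 f hf)⟩

lemma IsP1Automorphism.trans {α β : Equiv.Perm (P1 k)} (hα : IsP1Automorphism α)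
    (hβ : IsP1Automorphism β) : IsP1Automorphism (α.trans β) :=
  ⟨hα.1.comp hβ.1, hβ.2.comp hα.2⟩

end P1

/-! ### Lines on a toric variety -/

section Lines

variable {k : Type*} [Field k] {N : Type*} [AddCommGroup N] {F : Fan N}

/-- On the open set `V` the map `φ` is the morphism `ψ : V → U_σ = Spec k[σ^∨ ∩ M]`. -/
structure IsLocalMorphism (φ : P1 k → ToricVariety k F) (V : Set (P1 k)) (σ : F.cones)
    (ψ : P1 k → AffinePoint k (σ : PointedCone ℚ (NQ N))) : Prop where
  isOpen : IsZariskiOpen V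
  eq_chart : ∀ q ∈ V, φ q = chart σ (ψ q)
  regular : ∀ f : CoordRing k (σ : PointedCone ℚ (NQ N)), IsRegularOn V (fun q => ψ q f)

/-- Morphisms of varieties from the projective line to `X(Σ)`. -/
def IsMorphism (φ : P1 k → ToricVariety k F) : Prop :=
  ∀ p, ∃ V σ ψ, p ∈ V ∧ IsLocalMorphism φ V σ ψ

/-- Torically transverse maps: the preimage of the big torus is dense and the image is disjoint
from all toric strata of codimension `> 1`. -/
structure IsToricallyTransverse (φ : P1 k → ToricVariety k F) : Prop where
  dense : ∀ V : Set (P1 k), IsZariskiOpen V → V.Nonempty → ∃ p ∈ V, φ p ∈ bigTorus k F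
  disjoint : ∀ σ : F.cones, 1 < coneDim (σ : PointedCone ℚ (NQ N)) →
    ∀ p, φ p ∉ stratum k F σ

/-- Lines on `X(Σ)`. -/
structure IsLine (φ : P1 k → ToricVariety k F) : Prop where
  morphism : IsMorphism φ
  nonconstant : ∃ p q, φ p ≠ φ q
  transverse : IsToricallyTransverse φ
  card_le : (φ ⁻¹' boundary k F).encard ≤ 3

/-- At `p` the map `φ` meets the toric prime divisor `D_u` of the ray `ℚ_{≥0} u ∈ Σ` with
intersection multiplicity `w`. On `U_{ℚ_{≥0} u}` this divisor has the equation `χ^m = 0` for any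
`m ∈ M` with `⟨m, u⟩ = 1`. -/
def MeetsDivisorWithMult (φ : P1 k → ToricVariety k F) (p : P1 k) (u : N) (w : ℕ) : Prop :=
  ∃ hu : ray u ∈ F.cones, φ p ∈ stratum k F ⟨ray u, hu⟩ ∧
    ∃ V ψ, p ∈ V ∧ IsLocalMorphism φ V ⟨ray u, hu⟩ ψ ∧
      ∃ m : dualMonoid (ray u), (m : Module.Dual ℤ N) u = 1 ∧
        HasOrderAt (fun q => ψ q (chi m)) p w

/-- Lines of type `(𝐮, 𝐰) = (u_i, w_i)_i`: the preimage of the toric boundary consists of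
distinct points `p_i`, and at `p_i` the line meets the divisor of `u_i` with multiplicity
`w_i`. -/
structure IsLineOfType {a : ℕ} (u : Fin a → N) (w : Fin a → ℕ) (φ : P1 k → ToricVariety k F) :
    Prop where
  isLine : IsLine φ
  hasType : ∃ p : Fin a → P1 k, Function.Injective p ∧ Set.range p = φ ⁻¹' boundary k F ∧
    ∀ i, MeetsDivisorWithMult φ (p i) (u i) (w i)

lemma IsLocalMorphism.smul (g : Torus k N) {φ : P1 k → ToricVariety k F} {V : Set (P1 k)}
    {σ : F.cones} {ψ : P1 k → AffinePoint k (σ : PointedCone ℚ (NQ N))}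
    (h : IsLocalMorphism φ V σ ψ) :
    IsLocalMorphism (fun q => g • φ q) V σ (fun q => g • ψ q) where
  isOpen := h.isOpen
  eq_chart q hq := by simp only [h.eq_chart q hq]; rfl
  regular f := h.regular (twist (σ : PointedCone ℚ (NQ N)) g f)

lemma smul_mem_stratum_iff {σ : F.cones} (g : Torus k N) {x : ToricVariety k F} :
    g • x ∈ stratum k F σ ↔ x ∈ stratum k F σ := by
  simp [stratum, smul_mem_orbit_iff]

lemma preimage_boundary_smul (g : Torus k N) (φ : P1 k → ToricVariety k F) :
    (fun q => g • φ q) ⁻¹' boundary k F = φ ⁻¹' boundary k F := by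
  ext q
  simp [boundary, bigTorus, smul_mem_orbit_iff]

lemma HasOrderAt.const_mul {f : P1 k → k} {p : P1 k} {w : ℕ} (h : HasOrderAt f p w) {c : k}
    (hc : c ≠ 0) : HasOrderAt (fun q => c * f q) p w := by
  obtain ⟨d, l, a, b, hl, hl0, hlp, ha, hb, hap, hbp, hf⟩ := h
  refine ⟨d, l, MvPolynomial.C c * a, b, hl, hl0, hlp, ?_, hb, ?_, hbp, fun q hq => ?_⟩
  · simpa using (MvPolynomial.isHomogeneous_C (Fin 2) c).mul ha
  · simpa [formVal] using ⟨hc, hap⟩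
  · simp only [hf q hq]
    simp only [formVal, map_mul, MvPolynomial.eval_C]
    ring

lemma IsLine.smul (g : Torus k N) {φ : P1 k → ToricVariety k F} (h : IsLine φ) :
    IsLine (fun q => g • φ q) where
  morphism p := by
    obtain ⟨V, σ, ψ, hp, hψ⟩ := h.morphism p
    exact ⟨V, σ, _, hp, hψ.smul g⟩
  nonconstant := by
    obtain ⟨p, q, hpq⟩ := h.nonconstant
    exact ⟨p, q, fun he => hpq ((MulAction.injective g) he)⟩
  transverse :=
    { dense := fun V hV hne => by
        obtain ⟨p, hp, hφ⟩ := h.transverse.dense V hV hne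
        exact ⟨p, hp, smul_mem_orbit g hφ⟩
      disjoint := fun σ hσ p hp => h.transverse.disjoint σ hσ p ((smul_mem_stratum_iff g).1 hp) }
  card_le := by rw [preimage_boundary_smul]; exact h.card_le

lemma MeetsDivisorWithMult.smul (g : Torus k N) {φ : P1 k → ToricVariety k F} {p : P1 k}
    {u : N} {w : ℕ} (h : MeetsDivisorWithMult φ p u w) :
    MeetsDivisorWithMult (fun q => g • φ q) p u w := by
  obtain ⟨hu, hp, V, ψ, hpV, hψ, m, hm, ho⟩ := h
  refine ⟨hu, (smul_mem_stratum_iff g).2 hp, V, _, hpV, hψ.smul g, m, hm, ?_⟩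
  simp only [smul_affine_chi]
  exact ho.const_mul (Units.ne_zero _)

lemma IsLineOfType.smul (g : Torus k N) {a : ℕ} {u : Fin a → N} {w : Fin a → ℕ}
    {φ : P1 k → ToricVariety k F} (h : IsLineOfType u w φ) :
    IsLineOfType u w (fun q => g • φ q) where
  isLine := h.isLine.smul g
  hasType := by
    obtain ⟨p, hp, hr, hm⟩ := h.hasType
    exact ⟨p, hp, by rw [preimage_boundary_smul, hr], fun i => (hm i).smul g⟩

variable (k F) in
/-- Isomorphism of lines of a fixed type: they differ by an automorphism of the projective
line. -/
def lineSetoid {a : ℕ} (u : Fin a → N) (w : Fin a → ℕ) :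
    Setoid {φ : P1 k → ToricVariety k F // IsLineOfType u w φ} where
  r φ φ' := ∃ α : Equiv.Perm (P1 k), IsP1Automorphism α ∧ φ'.1 = φ.1 ∘ α
  iseqv :=
    { refl := fun _ => ⟨_, isP1Automorphism_refl, rfl⟩
      symm := by
        rintro φ φ' ⟨α, hα, h⟩
        exact ⟨α.symm, hα.symm, by rw [h]; ext; simp⟩
      trans := by
        rintro φ φ' φ'' ⟨α, hα, h⟩ ⟨β, hβ, h'⟩
        exact ⟨β.trans α, hβ.trans hα, by rw [h', h]; rfl⟩ }

variable (k F) in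
/-- The space `𝔏_{(𝐮,𝐰)}` of lines of type `(𝐮, 𝐰)` on `X(Σ)`: isomorphism classes of such
lines. -/
def LineSpace {a : ℕ} (u : Fin a → N) (w : Fin a → ℕ) : Type _ := Quotient (lineSetoid k F u w)

/-- The action of the big torus on the space of lines, by composition with its action on
`X(Σ)`. -/
instance {a : ℕ} (u : Fin a → N) (w : Fin a → ℕ) :
    MulAction (Torus k N) (LineSpace k F u w) where
  smul g := Quotient.map (fun φ => ⟨fun q => g • φ.1 q, φ.2.smul g⟩) (by
    rintro φ φ' ⟨α, hα, h⟩
    exact ⟨α, hα, by simp only [h]; rfl⟩)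
  one_smul := by
    rintro ⟨φ⟩
    refine congrArg (Quotient.mk (lineSetoid k F u w)) (Subtype.ext (funext fun q => ?_))
    exact one_smul _ _
  mul_smul g h := by
    rintro ⟨φ⟩
    refine congrArg (Quotient.mk (lineSetoid k F u w)) (Subtype.ext (funext fun q => ?_))
    exact mul_smul _ _ _

end Lines

/-- Transitive actions: the space is nonempty and any two points differ by a group element. -/
def IsTransitive (G Y : Type*) [Group G] [MulAction G Y] : Prop :=
  Nonempty Y ∧ ∀ x y : Y, ∃ g : G, g • x = y

/-- Simply transitive actions: the space is nonempty and any two points differ by a unique group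
element. -/
def IsSimplyTransitive (G Y : Type*) [Group G] [MulAction G Y] : Prop :=
  Nonempty Y ∧ ∀ x y : Y, ∃! g : G, g • x = y

end ToricLines

end

/-! A line is determined by its characters: along a line `φ`, each `χ^m` restricts to a rational
function on the projective line. Near `p i` it factors as `χ^m = (χ^m₀)^⟨m, u_i⟩ · χ^m'` with `⟨m₀,
u_i⟩ = 1` and `⟨m', u_i⟩ = 0`. Here `χ^m₀` is an equation of the divisor and `χ^m'` is invertible,
so the divisor of `χ^m` along `φ` is `∑ w_i ⟨m, u_i⟩ p_i` (`IsLineThrough.hasGerm_of_notMem`,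
`IsLineThrough.hasGerm_boundary`).

Uniqueness: if two lines have the same boundary points, the quotient of their characters has neither
zeros nor poles, hence is constant for every `m`. These constants form a torus element carrying one
line to the other (`IsLineThrough.exists_smul_eq`). Linear automorphisms move any two or three
distinct points to any others, so the action on classes is transitive (`exists_smul_lineSpace_eq`).

Existence: the balancing condition says that `∑ w_i ⟨m, u_i⟩ p_i` has degree zero, so `χ^m ↦ ∏ l_j ^
(w_j ⟨m, u_j⟩)`, with `l_j` a linear form vanishing at `p j`, defines a line
(`isLineOfType_stdLine`).

Stabilizers: `g` fixes the class of `φ` iff `g • φ = φ ∘ α` for an automorphism `α` of the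
projective line, and such an `α` permutes the boundary points. The acting group is commutative and
transitive, so one line suffices. For three boundary points, put at `0, 1, ∞`, every permutation of
them is induced by an automorphism with a further fixed point `q`; then `g` fixes `φ q` in the big
torus, where the action is free, so `g = 1` (`eq_one_of_smul_stdLine_eq`). For two boundary points,
balancing gives `u_1 = -u_0` and `w_1 = w_0`, and `χ^m` becomes `(c t) ^ (w_0 ⟨m, u_0⟩)`. The
scalings of `t` then realize exactly the `g` that are trivial on `u_0^⊥` (`smul_stdLine_eq_iff`).
These form the kernel of the split projection to the torus of `N/ℤu_0`, whence the simply transitive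
quotient action. -/

noncomputable section

namespace ToricLines

/-! ### Forms on the projective line and constancy of global regular functions. -/

section ProjectiveLine

open MvPolynomial

variable {k : Type*} [Field k]

/-- The determinant of two vectors in the plane. -/
def cross (v w : Fin 2 → k) : k := v 0 * w 1 - v 1 * w 0

lemma vec_ne_zero_iff {v : Fin 2 → k} : v ≠ 0 ↔ v 0 ≠ 0 ∨ v 1 ≠ 0 := by
  rw [Ne, funext_iff, Fin.forall_fin_two]
  simp only [Pi.zero_apply]
  tauto

lemma mk_eq_mk_iff_cross {v w : Fin 2 → k} (hv : v ≠ 0) (hw : w ≠ 0) :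
    Projectivization.mk k v hv = Projectivization.mk k w hw ↔ cross v w = 0 := by
  rw [Projectivization.mk_eq_mk_iff', cross]
  constructor
  · rintro ⟨c, rfl⟩
    simp only [Pi.smul_apply, smul_eq_mul]
    ring
  · intro h
    rcases vec_ne_zero_iff.1 hw with h0 | h1
    · refine ⟨v 0 / w 0, ?_⟩
      ext i
      fin_cases i
      · simp [h0]
      · simp only [Fin.mk_one, Pi.smul_apply, smul_eq_mul]
        field_simp
        linear_combination h
    · refine ⟨v 1 / w 1, ?_⟩
      ext i
      fin_cases i
      · simp only [Fin.zero_eta, Pi.smul_apply, smul_eq_mul]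
        field_simp
        linear_combination -h
      · simp [h1]

lemma eq_iff_cross_rep {p q : P1 k} : p = q ↔ cross p.rep q.rep = 0 := by
  conv_lhs => rw [← p.mk_rep, ← q.mk_rep]
  exact mk_eq_mk_iff_cross _ _

lemma eval_smul_of_isHomogeneous {f : MvPolynomial (Fin 2) k} {d : ℕ} (hf : f.IsHomogeneous d)
    (c : k) (v : Fin 2 → k) : eval (c • v) f = c ^ d * eval v f := by
  rw [eval_eq, eval_eq, Finset.mul_sum]
  refine Finset.sum_congr rfl fun m hm => ?_
  have hd : m.degree = d := by
    by_contra h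
    exact (mem_support_iff.1 hm) (hf.coeff_eq_zero h)
  simp only [Pi.smul_apply, smul_eq_mul, mul_pow, Finset.prod_mul_distrib, Finset.prod_pow_eq_pow_sum]
  rw [← hd, Finsupp.degree_apply]
  ring

/-- Passing from the chosen representative of a point to another one. -/
lemma formVal_mk {v : Fin 2 → k} (hv : v ≠ 0) :
    ∃ c : k, c ≠ 0 ∧ ∀ (f : MvPolynomial (Fin 2) k) (d : ℕ), f.IsHomogeneous d →
      formVal f (Projectivization.mk k v hv) = c ^ d * eval v f := by
  obtain ⟨a, ha⟩ := Projectivization.exists_smul_eq_mk_rep k v hv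
  refine ⟨a, a.ne_zero, fun f d hf => ?_⟩
  rw [formVal, ← ha]
  exact eval_smul_of_isHomogeneous hf _ _

lemma formVal_mk_ne_zero_iff {v : Fin 2 → k} (hv : v ≠ 0) {f : MvPolynomial (Fin 2) k} {d : ℕ}
    (hf : f.IsHomogeneous d) :
    formVal f (Projectivization.mk k v hv) ≠ 0 ↔ eval v f ≠ 0 := by
  obtain ⟨c, hc, h⟩ := formVal_mk hv
  rw [h f d hf]
  simp [hc]

@[simp] lemma formVal_mul (f g : MvPolynomial (Fin 2) k) (q : P1 k) :
    formVal (f * g) q = formVal f q * formVal g q := by simp [formVal]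

@[simp] lemma formVal_sub (f g : MvPolynomial (Fin 2) k) (q : P1 k) :
    formVal (f - g) q = formVal f q - formVal g q := by simp [formVal]

@[simp] lemma formVal_add (f g : MvPolynomial (Fin 2) k) (q : P1 k) :
    formVal (f + g) q = formVal f q + formVal g q := by simp [formVal]

@[simp] lemma formVal_pow (f : MvPolynomial (Fin 2) k) (n : ℕ) (q : P1 k) :
    formVal (f ^ n) q = formVal f q ^ n := by simp [formVal]

@[simp] lemma formVal_C (c : k) (q : P1 k) : formVal (C c) q = c := by simp [formVal]

@[simp] lemma formVal_one (q : P1 k) : formVal 1 q = 1 := by simp [formVal]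

@[simp] lemma formVal_X (i : Fin 2) (q : P1 k) : formVal (X i) q = q.rep i := by simp [formVal]

@[simp] lemma formVal_prod {ι : Type*} (s : Finset ι) (f : ι → MvPolynomial (Fin 2) k) (q : P1 k) :
    formVal (∏ i ∈ s, f i) q = ∏ i ∈ s, formVal (f i) q := by simp [formVal]

/-- The linear form with zero `p`. -/
def linForm (p : P1 k) : MvPolynomial (Fin 2) k := C (p.rep 0) * X 1 - C (p.rep 1) * X 0

lemma isHomogeneous_linForm (p : P1 k) : (linForm p).IsHomogeneous 1 :=
  (isHomogeneous_C_mul_X _ _).sub (isHomogeneous_C_mul_X _ _)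

lemma formVal_linForm (p q : P1 k) : formVal (linForm p) q = cross p.rep q.rep := by
  simp [linForm, cross]

lemma formVal_linForm_eq_zero_iff {p q : P1 k} : formVal (linForm p) q = 0 ↔ q = p := by
  rw [formVal_linForm, ← eq_iff_cross_rep, eq_comm]

lemma exists_point_ne (p : P1 k) : ∃ q, q ≠ p := by
  by_cases h : p.rep 0 = 0
  · refine ⟨Projectivization.mk k ![1, 0] (by simp), fun he => p.rep_nonzero ?_⟩
    rw [← p.mk_rep, mk_eq_mk_iff_cross] at he
    simp only [cross, Matrix.cons_val_zero, Matrix.cons_val_one] at he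
    ext i
    fin_cases i
    · exact h
    · simpa using he
  · refine ⟨Projectivization.mk k ![0, 1] (by simp), fun he => h ?_⟩
    rw [← p.mk_rep, mk_eq_mk_iff_cross] at he
    simpa [cross] using he

lemma linForm_ne_zero (p : P1 k) : linForm p ≠ 0 := by
  obtain ⟨q, hq⟩ := exists_point_ne p
  intro h
  apply hq
  rw [← formVal_linForm_eq_zero_iff, h]
  simp [formVal]

/-- A linear form vanishing at `p` is a multiple of `linForm p`. -/
lemma exists_formVal_eq_const_mul_linForm {l : MvPolynomial (Fin 2) k} (hl : l.IsHomogeneous 1)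
    (hl0 : l ≠ 0) {p : P1 k} (hp : formVal l p = 0) :
    ∃ c : k, c ≠ 0 ∧ ∀ q, formVal l q = c * formVal (linForm p) q := by
  obtain ⟨x, y, hxy⟩ : ∃ x y : k, l = C x * X 0 + C y * X 1 := by
    have := (mem_homogeneousSubmodule 1 l).2 hl
    rw [homogeneousSubmodule_one_eq_span_X, Submodule.mem_span_range_iff_exists_fun] at this
    obtain ⟨c, hc⟩ := this
    refine ⟨c 0, c 1, ?_⟩
    rw [← hc, Fin.sum_univ_two, smul_eq_C_mul, smul_eq_C_mul]
  have hne := vec_ne_zero_iff.1 p.rep_nonzero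
  rw [hxy] at hp
  simp only [formVal_add, formVal_mul, formVal_C, formVal_X] at hp
  have key : ∃ c : k, x = -c * p.rep 1 ∧ y = c * p.rep 0 := by
    rcases hne with h0 | h1
    · refine ⟨y / p.rep 0, ?_, by field_simp⟩
      field_simp
      linear_combination hp
    · refine ⟨-x / p.rep 1, by field_simp, ?_⟩
      field_simp
      linear_combination hp
  obtain ⟨c, hx, hy⟩ := key
  refine ⟨c, ?_, fun q => ?_⟩
  · rintro rfl
    apply hl0
    simp [hxy, hx, hy]
  · rw [formVal_linForm, hxy, cross]
    simp only [formVal_add, formVal_mul, formVal_C, formVal_X, hx, hy]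
    ring

lemma ne_zero_of_formVal_ne_zero {f : MvPolynomial (Fin 2) k} {q : P1 k} (h : formVal f q ≠ 0) :
    f ≠ 0 := by
  rintro rfl
  simp [formVal] at h

section Infinite

variable [Infinite k]

lemma exists_formVal_ne_zero {f : MvPolynomial (Fin 2) k} {d : ℕ} (hf : f.IsHomogeneous d)
    (h0 : f ≠ 0) : ∃ q, formVal f q ≠ 0 := by
  -- The factor `X 0` keeps the vector where the product does not vanish away from the origin, so
  -- that it represents a point.
  have hne : f * X 0 ≠ 0 := mul_ne_zero h0 (X_ne_zero _)
  obtain ⟨v, hv⟩ : ∃ v, eval v (f * X 0) ≠ 0 := by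
    by_contra! h
    exact hne (MvPolynomial.funext fun v => by simpa using h v)
  simp only [map_mul, eval_X, ne_eq, mul_eq_zero, not_or] at hv
  have hv0 : v ≠ 0 := vec_ne_zero_iff.2 (Or.inl hv.2)
  exact ⟨_, (formVal_mk_ne_zero_iff hv0 hf).2 hv.1⟩

/-- Density of the complement of the zeros of `s`: the product `f * s` vanishes at every point. -/
lemma eq_zero_of_formVal_eq_zero {f s : MvPolynomial (Fin 2) k} {d e : ℕ} (hf : f.IsHomogeneous d)
    (hs : s.IsHomogeneous e) (hs0 : s ≠ 0) (h : ∀ q, formVal s q ≠ 0 → formVal f q = 0) :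
    f = 0 := by
  by_contra h0
  obtain ⟨q, hq⟩ := exists_formVal_ne_zero (hf.mul hs) (mul_ne_zero h0 hs0)
  rw [formVal_mul] at hq
  exact left_ne_zero_of_mul hq (h q (right_ne_zero_of_mul hq))

end Infinite

/-! Dehomogenization and constancy of global regular functions. -/

/-- A function on a subset of the affine line which locally is a quotient of polynomials is a
polynomial. -/
lemma exists_polynomial_of_locally_quotient [IsAlgClosed k] (Z : Set k) (h : k → k)
    (H : ∀ t₀, ∃ A B : Polynomial k, B.eval t₀ ≠ 0 ∧
      ∀ t ∈ Z, B.eval t ≠ 0 → h t = A.eval t / B.eval t) :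
    ∃ P : Polynomial k, ∀ t ∈ Z, h t = P.eval t := by
  -- The ideal of denominators of `h`. Were it proper, its generator would have a root `t₀`, while
  -- the local expression at `t₀` supplies a denominator that does not vanish there.
  let I : Ideal (Polynomial k) :=
    { carrier := {B | ∃ A : Polynomial k, ∀ t ∈ Z, B.eval t * h t = A.eval t}
      zero_mem' := ⟨0, by simp⟩
      add_mem' := by
        rintro B B' ⟨A, hA⟩ ⟨A', hA'⟩
        exact ⟨A + A', fun t ht => by simp [add_mul, hA t ht, hA' t ht]⟩
      smul_mem' := by
        rintro c B ⟨A, hA⟩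
        exact ⟨c * A, fun t ht => by simp [mul_assoc, hA t ht]⟩ }
  have hI : I = ⊤ := by
    by_contra hne
    obtain ⟨G, hG⟩ : ∃ G, I = Ideal.span {G} :=
      ⟨_, (Ideal.span_singleton_generator I).symm⟩
    have hdeg : G.degree ≠ 0 := by
      intro h0
      apply hne
      rw [hG, Ideal.span_singleton_eq_top]
      exact Polynomial.isUnit_iff_degree_eq_zero.2 h0
    obtain ⟨t₀, ht₀⟩ := IsAlgClosed.exists_root G hdeg
    obtain ⟨A, B, hB, hAB⟩ := H t₀
    -- The square is needed: at zeros of `B` nothing is known about `h`, and the extra factor makes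
    -- both sides vanish there.
    have hmem : B * B ∈ I := by
      refine ⟨A * B, fun t ht => ?_⟩
      by_cases hBt : B.eval t = 0
      · simp [hBt]
      · rw [hAB t ht hBt, Polynomial.eval_mul, Polynomial.eval_mul]
        field_simp
    rw [hG, Ideal.mem_span_singleton] at hmem
    obtain ⟨R, hR⟩ := hmem
    have := congrArg (Polynomial.eval t₀) hR
    rw [Polynomial.eval_mul, Polynomial.eval_mul, ht₀.eq_zero, zero_mul] at this
    exact hB (mul_self_eq_zero.1 this)
  have h1 : (1 : Polynomial k) ∈ I := by rw [hI]; trivial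
  obtain ⟨P, hP⟩ := h1
  exact ⟨P, fun t ht => by simpa using hP t ht⟩

/-- The polynomial `f(T, 1)`. -/
def dehom₀ (f : MvPolynomial (Fin 2) k) : Polynomial k := aeval ![Polynomial.X, 1] f

/-- The polynomial `f(1, T)`. -/
def dehom₁ (f : MvPolynomial (Fin 2) k) : Polynomial k := aeval ![1, Polynomial.X] f

lemma eval_dehom₀ (f : MvPolynomial (Fin 2) k) (t : k) :
    (dehom₀ f).eval t = eval ![t, 1] f := by
  have : (Polynomial.evalRingHom t).comp (aeval ![Polynomial.X, 1] :
      MvPolynomial (Fin 2) k →ₐ[k] Polynomial k).toRingHom = eval ![t, 1] := by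
    refine MvPolynomial.ringHom_ext (fun c => by simp) fun i => ?_
    fin_cases i <;> simp
  exact congrArg (fun g : MvPolynomial (Fin 2) k →+* k => g f) this

lemma eval_dehom₁ (f : MvPolynomial (Fin 2) k) (t : k) :
    (dehom₁ f).eval t = eval ![1, t] f := by
  have : (Polynomial.evalRingHom t).comp (aeval ![1, Polynomial.X] :
      MvPolynomial (Fin 2) k →ₐ[k] Polynomial k).toRingHom = eval ![1, t] := by
    refine MvPolynomial.ringHom_ext (fun c => by simp) fun i => ?_
    fin_cases i <;> simp
  exact congrArg (fun g : MvPolynomial (Fin 2) k →+* k => g f) this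

/-- The point `[t : 1]`. -/
def affPt (t : k) : P1 k := Projectivization.mk k ![t, 1] (by simp)

/-- The point `[1 : t]`. -/
def affPt' (t : k) : P1 k := Projectivization.mk k ![1, t] (by simp)

lemma formVal_div_affPt {a b : MvPolynomial (Fin 2) k} {d : ℕ} (ha : a.IsHomogeneous d)
    (hb : b.IsHomogeneous d) (t : k) :
    formVal a (affPt t) / formVal b (affPt t) = (dehom₀ a).eval t / (dehom₀ b).eval t := by
  obtain ⟨c, hc, h⟩ := formVal_mk (k := k) (v := ![t, 1]) (by simp)
  rw [affPt, h a d ha, h b d hb, eval_dehom₀, eval_dehom₀, mul_div_mul_left _ _ (pow_ne_zero d hc)]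

lemma formVal_div_affPt' {a b : MvPolynomial (Fin 2) k} {d : ℕ} (ha : a.IsHomogeneous d)
    (hb : b.IsHomogeneous d) (t : k) :
    formVal a (affPt' t) / formVal b (affPt' t) = (dehom₁ a).eval t / (dehom₁ b).eval t := by
  obtain ⟨c, hc, h⟩ := formVal_mk (k := k) (v := ![1, t]) (by simp)
  rw [affPt', h a d ha, h b d hb, eval_dehom₁, eval_dehom₁, mul_div_mul_left _ _ (pow_ne_zero d hc)]

lemma formVal_affPt_ne_zero_iff {f : MvPolynomial (Fin 2) k} {d : ℕ} (hf : f.IsHomogeneous d)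
    {t : k} : formVal f (affPt t) ≠ 0 ↔ (dehom₀ f).eval t ≠ 0 := by
  rw [affPt, formVal_mk_ne_zero_iff _ hf, eval_dehom₀]

lemma formVal_affPt'_ne_zero_iff {f : MvPolynomial (Fin 2) k} {d : ℕ} (hf : f.IsHomogeneous d)
    {t : k} : formVal f (affPt' t) ≠ 0 ↔ (dehom₁ f).eval t ≠ 0 := by
  rw [affPt', formVal_mk_ne_zero_iff _ hf, eval_dehom₁]

lemma affPt_eq_affPt' {t : k} (ht : t ≠ 0) : affPt t = affPt' t⁻¹ := by
  rw [affPt, affPt', mk_eq_mk_iff_cross]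
  simp [cross, ht]

lemma eq_affPt {q : P1 k} (h : q.rep 1 ≠ 0) : q = affPt (q.rep 0 / q.rep 1) := by
  conv_lhs => rw [← q.mk_rep]
  rw [affPt, mk_eq_mk_iff_cross]
  simp only [cross, Matrix.cons_val_zero, Matrix.cons_val_one]
  field_simp
  ring

/-- A function on a nonempty Zariski open subset of the projective line that is locally, around
every point of the line, a quotient of forms of the same degree is constant. -/
lemma exists_eq_const_of_locally_quotient [IsAlgClosed k] {s : MvPolynomial (Fin 2) k} {e : ℕ}
    (hs : s.IsHomogeneous e) (hs0 : s ≠ 0) (h : P1 k → k)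
    (H : ∀ p, ∃ (d : ℕ) (a b : MvPolynomial (Fin 2) k), a.IsHomogeneous d ∧ b.IsHomogeneous d ∧
      formVal b p ≠ 0 ∧ ∀ q, formVal s q ≠ 0 → formVal b q ≠ 0 →
        h q = formVal a q / formVal b q) :
    ∃ c, ∀ q, formVal s q ≠ 0 → h q = c := by
  obtain ⟨P, hP⟩ := exists_polynomial_of_locally_quotient {t | formVal s (affPt t) ≠ 0}
    (fun t => h (affPt t)) (fun t₀ => by
      obtain ⟨d, a, b, ha, hb, hp, hq⟩ := H (affPt t₀)
      refine ⟨dehom₀ a, dehom₀ b, (formVal_affPt_ne_zero_iff hb).1 hp, fun t ht hbt => ?_⟩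
      rw [hq _ ht ((formVal_affPt_ne_zero_iff hb).2 hbt), formVal_div_affPt ha hb])
  obtain ⟨Q, hQ⟩ := exists_polynomial_of_locally_quotient {t | formVal s (affPt' t) ≠ 0}
    (fun t => h (affPt' t)) (fun t₀ => by
      obtain ⟨d, a, b, ha, hb, hp, hq⟩ := H (affPt' t₀)
      refine ⟨dehom₁ a, dehom₁ b, (formVal_affPt'_ne_zero_iff hb).1 hp, fun t ht hbt => ?_⟩
      rw [hq _ ht ((formVal_affPt'_ne_zero_iff hb).2 hbt), formVal_div_affPt' ha hb])
  have hinf : Infinite k := IsAlgClosed.instInfinite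
  have hds : dehom₀ s ≠ 0 := by
    obtain ⟨q, hq⟩ := exists_formVal_ne_zero (hs.mul (isHomogeneous_X k 1))
      (mul_ne_zero hs0 (X_ne_zero _))
    rw [formVal_mul, formVal_X] at hq
    have hq1 := eq_affPt (right_ne_zero_of_mul hq)
    have hsq := left_ne_zero_of_mul hq
    rw [hq1, formVal_affPt_ne_zero_iff hs] at hsq
    intro h0
    simp [h0] at hsq
  -- On the overlap of the two affine charts `P(t) = Q(1/t)`. Clearing denominators and comparing
  -- degrees then forces `P` to be constant. The factor `T · s(T, 1)` below discards `t = 0` and the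
  -- zeros of `s`.
  have hPQ : P * Polynomial.X ^ Q.natDegree = Q.reverse := by
    have : (P * Polynomial.X ^ Q.natDegree - Q.reverse) * (Polynomial.X * dehom₀ s) = 0 := by
      refine Polynomial.funext fun t => ?_
      by_cases ht : t = 0
      · simp [ht]
      by_cases hst : (dehom₀ s).eval t = 0
      · simp [hst]
      rw [Polynomial.eval_mul, Polynomial.eval_zero]
      refine mul_eq_zero_of_left ?_ _
      have h1 := hP t ((formVal_affPt_ne_zero_iff hs).2 hst)
      have h2 := hQ t⁻¹ (by
        rw [Set.mem_ofPred_eq, ← affPt_eq_affPt' ht]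
        exact (formVal_affPt_ne_zero_iff hs).2 hst)
      simp only [← affPt_eq_affPt' ht] at h2
      rw [h1] at h2
      let : Invertible t⁻¹ := invertibleOfNonzero (inv_ne_zero ht)
      have h3 := Polynomial.eval₂_reverse_mul_pow (RingHom.id k) t⁻¹ Q
      rw [invOf_eq_inv, inv_inv, ← Polynomial.eval, ← Polynomial.eval, ← h2, inv_pow] at h3
      rw [Polynomial.eval_sub, Polynomial.eval_mul, Polynomial.eval_pow, Polynomial.eval_X, ← h3]
      field_simp
      ring
    rcases mul_eq_zero.1 this with h | h
    · exact sub_eq_zero.1 h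
    · exact absurd h (mul_ne_zero Polynomial.X_ne_zero hds)
  obtain ⟨c, hc⟩ : ∃ c, P = Polynomial.C c := by
    by_cases hP0 : P = 0
    · exact ⟨0, by simp [hP0]⟩
    have h1 := congrArg Polynomial.natDegree hPQ
    rw [Polynomial.natDegree_mul hP0 (pow_ne_zero _ Polynomial.X_ne_zero),
      Polynomial.natDegree_X_pow] at h1
    have h2 := Polynomial.reverse_natDegree_le Q
    exact ⟨_, Polynomial.eq_C_of_natDegree_eq_zero (by omega)⟩
  refine ⟨c, fun q hq => ?_⟩
  have haff : ∀ q, formVal (s * X 1) q ≠ 0 → h q = c := by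
    intro q hq
    rw [formVal_mul, formVal_X] at hq
    have hq1 := eq_affPt (right_ne_zero_of_mul hq)
    have hsq := left_ne_zero_of_mul hq
    rw [hq1] at hsq ⊢
    rw [hP _ hsq, hc, Polynomial.eval_C]
  obtain ⟨d, a, b, ha, hb, hbq, hab⟩ := H q
  -- The value `c` is known only off the point at infinity. It is carried over to an arbitrary `q`
  -- because `a - c b` vanishes on a dense set, hence identically.
  have hz : a - C c * b = 0 := by
    have hc : (C c * b).IsHomogeneous d := by simpa using hb.C_mul c
    refine eq_zero_of_formVal_eq_zero (ha.sub hc) ((hs.mul (isHomogeneous_X k 1)).mul hb)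
      (mul_ne_zero (mul_ne_zero hs0 (X_ne_zero _)) (ne_zero_of_formVal_ne_zero hbq)) fun r hr => ?_
    rw [formVal_mul] at hr
    have hbr := right_ne_zero_of_mul hr
    have hr1 := left_ne_zero_of_mul hr
    have h1 := haff r hr1
    rw [formVal_mul] at hr1
    rw [hab r (left_ne_zero_of_mul hr1) hbr] at h1
    rw [formVal_sub, formVal_mul, formVal_C, ← h1]
    field_simp
    ring
  rw [hab q hq hbq]
  have := congrArg (fun f => formVal f q) hz
  simp only [formVal_sub, formVal_mul, formVal_C] at this
  rw [div_eq_iff hbq]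
  have h0 : formVal (0 : MvPolynomial (Fin 2) k) q = 0 := by simp [formVal]
  rw [h0] at this
  linear_combination this

end ProjectiveLine

/-! ### Linear automorphisms of the projective line, and rigidity of all automorphisms. -/

section Automorphisms

open MvPolynomial

variable {k : Type*} [Field k]

/-- The linear forms given by the rows of the matrix of `e`. -/
def rowForm (e : (Fin 2 → k) ≃ₗ[k] (Fin 2 → k)) (i : Fin 2) : MvPolynomial (Fin 2) k :=
  C (e ![1, 0] i) * X 0 + C (e ![0, 1] i) * X 1

/-- Linear substitution in a form. -/
def linSubst (e : (Fin 2 → k) ≃ₗ[k] (Fin 2 → k)) (f : MvPolynomial (Fin 2) k) :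
    MvPolynomial (Fin 2) k := aeval (rowForm e) f

lemma eval_rowForm (e : (Fin 2 → k) ≃ₗ[k] (Fin 2 → k)) (i : Fin 2) (v : Fin 2 → k) :
    eval v (rowForm e i) = e v i := by
  have hv : v = v 0 • ![1, 0] + v 1 • ![0, 1] := by
    ext j
    fin_cases j <;> simp
  conv_rhs => rw [hv, map_add, map_smul, map_smul]
  simp only [rowForm, map_add, map_mul, eval_C, eval_X, Pi.add_apply, Pi.smul_apply, smul_eq_mul]
  ring

lemma eval_linSubst (e : (Fin 2 → k) ≃ₗ[k] (Fin 2 → k)) (f : MvPolynomial (Fin 2) k)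
    (v : Fin 2 → k) : eval v (linSubst e f) = eval (e v) f := by
  have : (eval v).comp (aeval (rowForm e) :
      MvPolynomial (Fin 2) k →ₐ[k] MvPolynomial (Fin 2) k).toRingHom = eval (e v) := by
    refine MvPolynomial.ringHom_ext (fun c => by simp) fun i => ?_
    simp [eval_rowForm]
  exact congrArg (fun g : MvPolynomial (Fin 2) k →+* k => g f) this

lemma isHomogeneous_linSubst (e : (Fin 2 → k) ≃ₗ[k] (Fin 2 → k)) {f : MvPolynomial (Fin 2) k}
    {d : ℕ} (hf : f.IsHomogeneous d) : (linSubst e f).IsHomogeneous d := by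
  have := hf.aeval (rowForm e) (n := 1) fun i =>
    (isHomogeneous_C_mul_X _ _).add (isHomogeneous_C_mul_X _ _)
  simpa [linSubst] using this

/-- The chosen representative of `e • q` is a multiple of `e q.rep`. One scalar `c` serves all
forms, so it cancels in quotients of forms of equal degree. -/
lemma formVal_linSubst (e : (Fin 2 → k) ≃ₗ[k] (Fin 2 → k)) (q : P1 k) :
    ∃ c : k, c ≠ 0 ∧ ∀ (f : MvPolynomial (Fin 2) k) (d : ℕ), f.IsHomogeneous d →
      formVal f (e • q) = c ^ d * formVal (linSubst e f) q := by
  have hv : e q.rep ≠ 0 := by simpa using q.rep_nonzero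
  have hq : e • q = Projectivization.mk k (e q.rep) hv := by
    conv_lhs => rw [← q.mk_rep, Projectivization.smul_mk]
    rfl
  obtain ⟨c, hc, h⟩ := formVal_mk hv
  refine ⟨c, hc, fun f d hf => ?_⟩
  rw [hq, h f d hf, formVal, eval_linSubst]

lemma isP1Morphism_smul (e : (Fin 2 → k) ≃ₗ[k] (Fin 2 → k)) :
    IsP1Morphism (fun q : P1 k => e • q) := by
  refine fun V hV => ⟨fun p hp => ?_, fun f hf p hp => ?_⟩
  · obtain ⟨d, h, hh, hhp, hhV⟩ := hV _ hp
    refine ⟨d, linSubst e h, isHomogeneous_linSubst e hh, ?_, fun q hq => hhV _ ?_⟩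
    · obtain ⟨c, hc, hf⟩ := formVal_linSubst e p
      rw [hf h d hh] at hhp
      exact right_ne_zero_of_mul hhp
    · obtain ⟨c, hc, hf⟩ := formVal_linSubst e q
      rw [hf h d hh]
      exact mul_ne_zero (pow_ne_zero _ hc) hq
  · obtain ⟨d, a, b, ha, hb, hbp, hab⟩ := hf _ hp
    refine ⟨d, linSubst e a, linSubst e b, isHomogeneous_linSubst e ha,
      isHomogeneous_linSubst e hb, ?_, fun q hq hbq => ?_⟩
    · obtain ⟨c, hc, hf⟩ := formVal_linSubst e p
      rw [hf b d hb] at hbp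
      exact right_ne_zero_of_mul hbp
    · obtain ⟨c, hc, hf⟩ := formVal_linSubst e q
      have h0 : formVal b (e • q) ≠ 0 := by
        rw [hf b d hb]
        exact mul_ne_zero (pow_ne_zero _ hc) hbq
      rw [Function.comp_apply, hab _ hq h0, hf a d ha, hf b d hb,
        mul_div_mul_left _ _ (pow_ne_zero d hc)]

lemma isP1Automorphism_smul (e : (Fin 2 → k) ≃ₗ[k] (Fin 2 → k)) :
    IsP1Automorphism (MulAction.toPerm e : Equiv.Perm (P1 k)) :=
  ⟨isP1Morphism_smul e, isP1Morphism_smul e⁻¹⟩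

/-- All forms are pulled back along `e`. Numerator and denominator both have total degree `d + w`,
so the rescaling of representatives cancels. -/
lemma HasOrderAt.comp_smul {f : P1 k → k} {p : P1 k} {w : ℕ} {e : (Fin 2 → k) ≃ₗ[k] (Fin 2 → k)}
    (h : HasOrderAt f (e • p) w) : HasOrderAt (fun q => f (e • q)) p w := by
  obtain ⟨d, l, a, b, hl, hl0, hlp, ha, hb, hap, hbp, hf⟩ := h
  have hne : ∀ {g : MvPolynomial (Fin 2) k} {n : ℕ} (q : P1 k), g.IsHomogeneous n →
      (formVal g (e • q) = 0 ↔ formVal (linSubst e g) q = 0) := by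
    intro g n q hg
    obtain ⟨c, hc, h⟩ := formVal_linSubst e q
    rw [h g n hg]
    simp [hc]
  refine ⟨d, linSubst e l, linSubst e a, linSubst e b, isHomogeneous_linSubst e hl, ?_,
    (hne p hl).1 hlp, isHomogeneous_linSubst e ha, isHomogeneous_linSubst e hb,
    fun h => hap ((hne p ha).2 h), fun h => hbp ((hne p hb).2 h), fun q hq => ?_⟩
  · obtain ⟨c, hc, hlc⟩ := exists_formVal_eq_const_mul_linForm hl hl0 hlp
    obtain ⟨q, hq⟩ := exists_point_ne p
    refine ne_zero_of_formVal_ne_zero (q := q) fun h0 => ?_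
    rw [← hne q hl, hlc, mul_eq_zero, or_iff_right hc, formVal_linForm_eq_zero_iff] at h0
    exact hq (MulAction.injective e h0)
  · obtain ⟨c, hc, h⟩ := formVal_linSubst e q
    change f (e • q) = _
    rw [hf _ (fun h0 => hq ((hne q hb).1 h0)), h l 1 hl, h a d ha, h b _ hb]
    rw [pow_one, mul_pow, pow_add,
      show c ^ w * formVal (linSubst e l) q ^ w * (c ^ d * formVal (linSubst e a) q)
        = (c ^ d * c ^ w) * (formVal (linSubst e l) q ^ w * formVal (linSubst e a) q) by ring,
      mul_div_mul_left _ _ (mul_ne_zero (pow_ne_zero d hc) (pow_ne_zero w hc))]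

/-- The linear automorphism with matrix `!![a, b; c, d]`. -/
def mobius (a b c d : k) (h : a * d - b * c ≠ 0) : (Fin 2 → k) ≃ₗ[k] (Fin 2 → k) where
  toFun v := ![a * v 0 + b * v 1, c * v 0 + d * v 1]
  map_add' v w := by
    ext i
    fin_cases i <;> simp <;> ring
  map_smul' x v := by
    ext i
    fin_cases i <;> simp <;> ring
  invFun v := ![(d * v 0 - b * v 1) / (a * d - b * c), (a * v 1 - c * v 0) / (a * d - b * c)]
  left_inv v := by
    ext i
    fin_cases i <;> simp only [Fin.zero_eta, Fin.mk_one, Matrix.cons_val_zero,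
      Matrix.cons_val_one] <;> rw [div_eq_iff h] <;> ring
  right_inv v := by
    ext i
    fin_cases i <;> simp only [Fin.zero_eta, Fin.mk_one, Matrix.cons_val_zero,
      Matrix.cons_val_one] <;> rw [mul_div_assoc', mul_div_assoc', ← add_div, div_eq_iff h] <;> ring

lemma mobius_apply (a b c d : k) (h : a * d - b * c ≠ 0) (v : Fin 2 → k) :
    mobius a b c d h v = ![a * v 0 + b * v 1, c * v 0 + d * v 1] := rfl

lemma smul_mk_eq_mk_iff (e : (Fin 2 → k) ≃ₗ[k] (Fin 2 → k)) {v w : Fin 2 → k} (hv : v ≠ 0)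
    (hw : w ≠ 0) :
    e • Projectivization.mk k v hv = Projectivization.mk k w hw ↔ cross (e v) w = 0 := by
  rw [Projectivization.smul_mk, mk_eq_mk_iff_cross]
  rfl

variable (k) in
/-- Representatives of the points `0`, `1` and `∞`. -/
def stdVec : Fin 3 → Fin 2 → k := ![![0, 1], ![1, 1], ![1, 0]]

lemma stdVec_ne_zero (i : Fin 3) : stdVec k i ≠ 0 := by
  fin_cases i <;> simp [stdVec]

variable (k) in
/-- The points `0`, `1` and `∞`. -/
def stdPt (i : Fin 3) : P1 k := Projectivization.mk k (stdVec k i) (stdVec_ne_zero i)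

lemma stdPt_injective : Function.Injective (stdPt k) := by
  intro i j h
  rw [stdPt, stdPt, mk_eq_mk_iff_cross] at h
  revert h
  fin_cases i <;> fin_cases j <;> simp [stdVec, cross]

lemma exists_smul_stdPt {p : Fin 3 → P1 k} (hp : Function.Injective p) :
    ∃ e : (Fin 2 → k) ≃ₗ[k] (Fin 2 → k), ∀ i, e • stdPt k i = p i := by
  have hne : ∀ i j, i ≠ j → cross (p i).rep (p j).rep ≠ 0 := fun i j hij h =>
    hij (hp (eq_iff_cross_rep.2 h))
  have h01 := hne 0 1 (by decide)
  have h02 := hne 0 2 (by decide)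
  have h21 := hne 2 1 (by decide)
  set v₀ := (p 0).rep
  set v₁ := (p 1).rep
  set v₂ := (p 2).rep
  -- With brackets for `cross`, the columns are `[v₀,v₁] v₂` and `-[v₂,v₁] v₀`. They are scaled so
  -- that their sum, the image of `(1, 1)`, is `[v₀,v₂] v₁`.
  refine ⟨mobius (cross v₀ v₁ * v₂ 0) (cross v₂ v₁ * v₀ 0 * (-1))
    (cross v₀ v₁ * v₂ 1) (cross v₂ v₁ * v₀ 1 * (-1)) ?_, ?_⟩
  · have : cross v₀ v₁ * v₂ 0 * (cross v₂ v₁ * v₀ 1 * (-1)) -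
        cross v₂ v₁ * v₀ 0 * (-1) * (cross v₀ v₁ * v₂ 1) =
        cross v₀ v₁ * cross v₂ v₁ * cross v₀ v₂ := by
      simp only [cross]; ring
    rw [this]
    exact mul_ne_zero (mul_ne_zero h01 h21) h02
  · intro i
    rw [← (p i).mk_rep, stdPt, smul_mk_eq_mk_iff, mobius_apply]
    fin_cases i <;>
      simp only [stdVec, cross, Fin.zero_eta, Fin.mk_one, Fin.reduceFinMk, Matrix.cons_val_zero,
        Matrix.cons_val_one, Matrix.cons_val, v₀, v₁, v₂] <;> ring

lemma exists_smul_eq_of_three {p p' : Fin 3 → P1 k} (hp : Function.Injective p)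
    (hp' : Function.Injective p') :
    ∃ e : (Fin 2 → k) ≃ₗ[k] (Fin 2 → k), ∀ i, e • p' i = p i := by
  obtain ⟨e, he⟩ := exists_smul_stdPt hp
  obtain ⟨e', he'⟩ := exists_smul_stdPt hp'
  exact ⟨e * e'⁻¹, fun i => by rw [mul_smul, ← he', inv_smul_smul, he]⟩

lemma exists_smul_eq_of_two {p p' : Fin 2 → P1 k} (hp : Function.Injective p)
    (hp' : Function.Injective p') :
    ∃ e : (Fin 2 → k) ≃ₗ[k] (Fin 2 → k), ∀ i, e • p' i = p i := by
  obtain ⟨e, h0, h1⟩ := (MulAction.is_two_pretransitive_iff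
    (G := (Fin 2 → k) ≃ₗ[k] (Fin 2 → k)) (α := P1 k)).1
    (Projectivization.linearEquiv_is_two_pretransitive k (Fin 2 → k))
    (hp'.ne (show (0 : Fin 2) ≠ 1 by decide)) (hp.ne (show (0 : Fin 2) ≠ 1 by decide))
  exact ⟨e, Fin.forall_fin_two.2 ⟨h0, h1⟩⟩

/-! Rigidity of automorphisms. -/

lemma rep_one_eq_zero_iff {q : P1 k} : q.rep 1 = 0 ↔ q = affPt' 0 := by
  conv_rhs => rw [← q.mk_rep, affPt', mk_eq_mk_iff_cross]
  simp [cross]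

lemma affPt_injective : Function.Injective (affPt : k → P1 k) := by
  intro s t h
  rw [affPt, affPt, mk_eq_mk_iff_cross] at h
  simpa [cross, sub_eq_zero] using h

lemma affPt_ne_infty (t : k) : affPt t ≠ affPt' 0 := by
  rw [affPt, affPt', Ne, mk_eq_mk_iff_cross]
  simp [cross]

/-- Since only infinity goes to infinity, the affine coordinate pulls back to a function regular on
the whole affine line, that is, to a polynomial. -/
lemma exists_polynomial_of_isP1Morphism [IsAlgClosed k] {α : P1 k → P1 k} (hα : IsP1Morphism α)
    (h : ∀ q, α q = affPt' 0 ↔ q = affPt' 0) :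
    ∃ P : Polynomial k, ∀ t, α (affPt t) = affPt (P.eval t) := by
  have hV : IsZariskiOpen {q : P1 k | q.rep 1 ≠ 0} := fun p hp =>
    ⟨1, X 1, isHomogeneous_X _ _, by simpa using hp, fun q hq => by simpa using hq⟩
  have hreg : IsRegularOn {q : P1 k | q.rep 1 ≠ 0} (fun q => q.rep 0 / q.rep 1) := fun p hp =>
    ⟨1, X 0, X 1, isHomogeneous_X _ _, isHomogeneous_X _ _, by simpa using hp,
      fun q hq _ => by simp⟩
  have hmem : ∀ t, affPt t ∈ α ⁻¹' {q : P1 k | q.rep 1 ≠ 0} := fun t => by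
    rw [Set.mem_preimage, Set.mem_ofPred_eq, Ne, rep_one_eq_zero_iff, h]
    exact affPt_ne_infty t
  have hcomp := (hα _ hV).2 _ hreg
  obtain ⟨P, hP⟩ := exists_polynomial_of_locally_quotient Set.univ
    (fun t => (α (affPt t)).rep 0 / (α (affPt t)).rep 1) (fun t₀ => by
      obtain ⟨d, a, b, ha, hb, hbp, hab⟩ := hcomp _ (hmem t₀)
      refine ⟨dehom₀ a, dehom₀ b, (formVal_affPt_ne_zero_iff hb).1 hbp, fun t _ hbt => ?_⟩
      rw [← formVal_div_affPt ha hb]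
      exact hab _ (hmem t) ((formVal_affPt_ne_zero_iff hb).2 hbt))
  exact ⟨P, fun t => by rw [← hP t trivial]; exact eq_affPt (hmem t)⟩

/-- An automorphism of the projective line fixing `0`, `1` and `∞` is the identity. -/
lemma IsP1Automorphism.eq_of_fixes_stdPt [IsAlgClosed k] {α : Equiv.Perm (P1 k)}
    (hα : IsP1Automorphism α) (hfix : ∀ i, α (stdPt k i) = stdPt k i) (q : P1 k) : α q = q := by
  have hinf : Infinite k := IsAlgClosed.instInfinite
  have h0 : α (affPt 0) = affPt 0 := hfix 0
  have h1 : α (affPt 1) = affPt 1 := hfix 1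
  have h2 : α (affPt' 0) = affPt' 0 := hfix 2
  obtain ⟨P, hP⟩ := exists_polynomial_of_isP1Morphism hα.1 fun q =>
    ⟨fun h => α.injective (h.trans h2.symm), fun h => by rw [h, h2]⟩
  obtain ⟨Q, hQ⟩ := exists_polynomial_of_isP1Morphism hα.2 fun q => by
    rw [Equiv.symm_apply_eq, h2]
  -- Both `α` and its inverse are polynomial, so the degrees multiply to one and `α` is affine;
  -- fixing `0` and `1` makes it the identity.
  have hPQ : P.comp Q = Polynomial.X := by
    refine Polynomial.funext fun t => affPt_injective ?_
    rw [Polynomial.eval_comp, ← hP, ← hQ, Equiv.apply_symm_apply, Polynomial.eval_X]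
  have hdeg : P.natDegree = 1 := by
    have := congrArg Polynomial.natDegree hPQ
    rw [Polynomial.natDegree_comp, Polynomial.natDegree_X] at this
    exact Nat.eq_one_of_mul_eq_one_right this
  obtain ⟨x, -, y, rfl⟩ := Polynomial.natDegree_eq_one.1 hdeg
  have e0 := affPt_injective ((hP 0).symm.trans h0)
  have e1 := affPt_injective ((hP 1).symm.trans h1)
  simp only [Polynomial.eval_add, Polynomial.eval_mul, Polynomial.eval_C, Polynomial.eval_X,
    mul_zero, zero_add, mul_one] at e0 e1
  rw [e0, add_zero] at e1
  by_cases hq : q.rep 1 = 0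
  · rw [rep_one_eq_zero_iff.1 hq, h2]
  · rw [eq_affPt hq, hP, e0, e1]
    simp

/-- Automorphisms are determined by their values on `0`, `1` and `∞`. -/
lemma IsP1Automorphism.eq_smul [IsAlgClosed k] {α : Equiv.Perm (P1 k)} (hα : IsP1Automorphism α)
    {e : (Fin 2 → k) ≃ₗ[k] (Fin 2 → k)} (h : ∀ i, α (stdPt k i) = e • stdPt k i) (q : P1 k) :
    α q = e • q := by
  have := (hα.trans (isP1Automorphism_smul e⁻¹)).eq_of_fixes_stdPt (fun i => by
    rw [Equiv.trans_apply, h, MulAction.toPerm_apply, inv_smul_smul]) q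
  rw [Equiv.trans_apply, MulAction.toPerm_apply, inv_smul_eq_iff] at this
  exact this

/-- A permutation of `0`, `1` and `∞` is induced by a linear map that fixes a further point. -/
lemma exists_fixed_point_of_perm [IsAlgClosed k] [CharZero k] {s : Fin 3 → Fin 3}
    (hs : Function.Injective s) :
    ∃ e : (Fin 2 → k) ≃ₗ[k] (Fin 2 → k), (∀ i, e • stdPt k i = stdPt k (s i)) ∧
      ∃ q, e • q = q ∧ q ∉ Set.range (stdPt k) := by
  -- `ω` is a common fixed point of the two three-cycles `t ↦ 1/(1-t)` and `t ↦ (t-1)/t`.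
  obtain ⟨ω, hω⟩ : ∃ ω : k, ω * ω - ω + 1 = 0 := by
    obtain ⟨z, hz⟩ := IsAlgClosed.exists_pow_nat_eq (-3 : k) (n := 2) (by norm_num)
    exact ⟨(1 + z) / 2, by linear_combination hz / 4⟩
  have hω0 : ω ≠ 0 := by rintro rfl; simp at hω
  have hω1 : ω ≠ 1 := by rintro rfl; simp at hω
  have key : ∀ (a b c d : k) (h : a * d - b * c ≠ 0) (t : k), t ≠ 0 → t ≠ 1 →
      (a * t + b - t * (c * t + d) = 0) →
      (∀ i, mobius a b c d h • stdPt k i = stdPt k (s i)) →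
      ∃ e : (Fin 2 → k) ≃ₗ[k] (Fin 2 → k), (∀ i, e • stdPt k i = stdPt k (s i)) ∧
      ∃ q, e • q = q ∧ q ∉ Set.range (stdPt k) := by
    intro a b c d h t ht0 ht1 hfix hstd
    refine ⟨_, hstd, affPt t, ?_, ?_⟩
    · rw [affPt, smul_mk_eq_mk_iff, mobius_apply]
      simp only [cross, Matrix.cons_val_zero, Matrix.cons_val_one]
      linear_combination hfix
    · rintro ⟨i, hi⟩
      fin_cases i
      · exact ht0 (affPt_injective hi).symm
      · exact ht1 (affPt_injective hi).symm
      · exact affPt_ne_infty t hi.symm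
  have h01 := hs.ne (show (0 : Fin 3) ≠ 1 by decide)
  have h02 := hs.ne (show (0 : Fin 3) ≠ 2 by decide)
  have h12 := hs.ne (show (1 : Fin 3) ≠ 2 by decide)
  have cases : (s 0 = 0 ∧ s 1 = 1 ∧ s 2 = 2) ∨ (s 0 = 1 ∧ s 1 = 0 ∧ s 2 = 2) ∨
      (s 0 = 2 ∧ s 1 = 1 ∧ s 2 = 0) ∨ (s 0 = 0 ∧ s 1 = 2 ∧ s 2 = 1) ∨
      (s 0 = 1 ∧ s 1 = 2 ∧ s 2 = 0) ∨ (s 0 = 2 ∧ s 1 = 0 ∧ s 2 = 1) := by omega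
  have hstd : ∀ (a b c d : k) (h : a * d - b * c ≠ 0),
      cross ![b, d] (stdVec k (s 0)) = 0 → cross ![a + b, c + d] (stdVec k (s 1)) = 0 →
      cross ![a, c] (stdVec k (s 2)) = 0 →
      ∀ i, mobius a b c d h • stdPt k i = stdPt k (s i) := by
    intro a b c d h e0 e1 e2 i
    rw [stdPt, stdPt, smul_mk_eq_mk_iff, mobius_apply]
    fin_cases i
    · simpa [stdVec] using e0
    · simpa [stdVec] using e1
    · simpa [stdVec] using e2
  -- The six maps are `t`, `1-t`, `1/t`, `t/(t-1)`, `1/(1-t)`, `(t-1)/t`, with fixed points `2`,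
  -- `1/2`, `-1`, `2`, `ω`, `ω`. Characteristic zero separates the first four from `0` and `1`.
  rcases cases with ⟨h0, h1, h2⟩ | ⟨h0, h1, h2⟩ | ⟨h0, h1, h2⟩ | ⟨h0, h1, h2⟩ | ⟨h0, h1, h2⟩ |
    ⟨h0, h1, h2⟩
  · refine key 1 0 0 1 (by simp) 2 (by norm_num) (by norm_num) (by norm_num) (hstd _ _ _ _ _ ?_ ?_ ?_) <;>
      simp [h0, h1, h2, stdVec, cross]
  · refine key (-1) 1 0 1 (by simp) (1 / 2) (by norm_num) (by norm_num) (by norm_num) (hstd _ _ _ _ _ ?_ ?_ ?_) <;>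
      simp [h0, h1, h2, stdVec, cross]
  · refine key 0 1 1 0 (by simp) (-1) (by norm_num) (by norm_num) (by norm_num) (hstd _ _ _ _ _ ?_ ?_ ?_) <;>
      simp [h0, h1, h2, stdVec, cross]
  · refine key 1 0 1 (-1) (by simp) 2 (by norm_num) (by norm_num) (by norm_num) (hstd _ _ _ _ _ ?_ ?_ ?_) <;>
      simp [h0, h1, h2, stdVec, cross]
  · refine key 0 1 (-1) 1 (by simp) ω hω0 hω1 (by linear_combination hω) (hstd _ _ _ _ _ ?_ ?_ ?_) <;>
      simp [h0, h1, h2, stdVec, cross]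
  · refine key 1 (-1) 1 0 (by simp) ω hω0 hω1 (by linear_combination -hω) (hstd _ _ _ _ _ ?_ ?_ ?_) <;>
      simp [h0, h1, h2, stdVec, cross]

end Automorphisms

/-! ### Rays, faces and primitive vectors. -/

section Lattice

variable {N : Type*} [AddCommGroup N]

lemma pairing_tmul (m : Module.Dual ℤ N) (c : ℚ) (x : N) :
    pairing m (c ⊗ₜ[ℤ] x) = c * m x := by
  simp [pairing, mul_comm]

lemma pairing_add (a b : Module.Dual ℤ N) (v : NQ N) :
    pairing (a + b) v = pairing a v + pairing b v := by
  simp [pairing]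

lemma pairing_nsmul (n : ℕ) (m : Module.Dual ℤ N) (v : NQ N) :
    pairing (n • m) v = n * pairing m v := by
  simp [pairing]

lemma pairing_neg (m : Module.Dual ℤ N) (v : NQ N) : pairing (-m) v = -pairing m v := by
  simp [pairing]

lemma mem_dualMonoid_bot (m : Module.Dual ℤ N) :
    m ∈ dualMonoid (⊥ : PointedCone ℚ (NQ N)) := by
  intro v hv
  rw [(Submodule.mem_bot _).1 hv, map_zero]

lemma mem_ray_iff {u : N} {v : NQ N} : v ∈ ray u ↔ ∃ c : ℚ, 0 ≤ c ∧ v = c ⊗ₜ[ℤ] u := by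
  rw [ray, PointedCone.hull, Submodule.mem_span_singleton]
  constructor
  · rintro ⟨c, rfl⟩
    exact ⟨c, c.2, by
      rw [← Nonneg.coe_smul, TensorProduct.smul_tmul', smul_eq_mul, mul_one]⟩
  · rintro ⟨c, hc, rfl⟩
    exact ⟨⟨c, hc⟩, by rw [Nonneg.mk_smul]; simp [TensorProduct.smul_tmul']⟩

lemma mem_dualMonoid_ray_iff {u : N} {m : Module.Dual ℤ N} : m ∈ dualMonoid (ray u) ↔ 0 ≤ m u := by
  constructor
  · intro h
    have := h _ (mem_ray_iff.2 ⟨1, zero_le_one, rfl⟩)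
    rw [pairing_tmul, one_mul] at this
    exact_mod_cast this
  · intro h v hv
    obtain ⟨c, hc, rfl⟩ := mem_ray_iff.1 hv
    rw [pairing_tmul]
    exact mul_nonneg hc (by exact_mod_cast h)

lemma forall_mem_ray_pairing_eq_zero_iff {u : N} {m : Module.Dual ℤ N} :
    (∀ v ∈ ray u, pairing m v = 0) ↔ m u = 0 := by
  constructor
  · intro h
    have := h _ (mem_ray_iff.2 ⟨1, zero_le_one, rfl⟩)
    rw [pairing_tmul, one_mul] at this
    exact_mod_cast this
  · intro h v hv
    obtain ⟨c, hc, rfl⟩ := mem_ray_iff.1 hv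
    rw [pairing_tmul, h]
    simp

/-- If `τ = σ ∩ m^⊥` is a face of the polyhedral cone `σ`, every element of `τ^∨` is moved into
`σ^∨` by a multiple of `m`. -/
lemma exists_add_nsmul_mem_dualMonoid {σ τ : PointedCone ℚ (NQ N)} (hσ : σ.FG)
    {m : Module.Dual ℤ N} (hm : m ∈ dualMonoid σ)
    (hτ : ∀ v, v ∈ τ ↔ v ∈ σ ∧ pairing m v = 0) {a : Module.Dual ℤ N} (ha : a ∈ dualMonoid τ) :
    ∃ n₀ : ℕ, ∀ n ≥ n₀, a + n • m ∈ dualMonoid σ := by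
  obtain ⟨S, rfl⟩ := hσ
  have hmem : ∀ v ∈ S, v ∈ (Submodule.span _ (S : Set (NQ N)) : PointedCone ℚ (NQ N)) :=
    fun v hv => Submodule.subset_span hv
  -- A generator at which `m` vanishes lies in `τ`, where `a` is nonnegative; at any other generator
  -- `m` is positive, and a large multiple of it outweighs `a`.
  have hgen : ∀ v ∈ S, ∃ n₀ : ℕ, ∀ n ≥ n₀, 0 ≤ pairing (a + n • m) v := by
    intro v hv
    simp only [pairing_add, pairing_nsmul]
    rcases (hm v (hmem v hv)).eq_or_lt with h0 | h0
    · refine ⟨0, fun n _ => ?_⟩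
      rw [← h0, mul_zero, add_zero]
      exact ha v ((hτ v).2 ⟨hmem v hv, h0.symm⟩)
    · obtain ⟨n₀, hn₀⟩ := exists_nat_ge (-pairing a v / pairing m v)
      refine ⟨n₀, fun n hn => ?_⟩
      have h1 : -pairing a v / pairing m v ≤ n := hn₀.trans (by exact_mod_cast hn)
      rw [div_le_iff₀ h0] at h1
      linarith
  choose! f hf using hgen
  refine ⟨S.sup f, fun n hn v hv => ?_⟩
  induction hv using Submodule.span_induction with
  | mem v hv => exact hf v hv n ((Finset.le_sup hv).trans hn)
  | zero => simp
  | add v w _ _ h1 h2 => rw [map_add]; exact add_nonneg h1 h2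
  | smul c v _ h1 =>
    rw [show c • v = (c : ℚ) • v from rfl, map_smul, smul_eq_mul]
    exact mul_nonneg c.2 h1

variable [Module.Free ℤ N] [Module.Finite ℤ N]

/-- A primitive vector takes the value `1` under a suitable linear form. -/
lemma IsPrimitive.exists_dual_eq_one {u : N} (hu : IsPrimitive u) :
    ∃ m : Module.Dual ℤ N, m u = 1 := by
  -- The values at `u` of all linear forms make up an ideal `dℤ`. All coordinates of `u` are
  -- divisible by `d`, so primitivity makes `d` a unit.
  obtain ⟨d, hd⟩ : ∃ d : ℤ, LinearMap.range (Module.Dual.eval ℤ N u) = Ideal.span {d} :=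
    ⟨_, (Submodule.IsPrincipal.span_singleton_generator _).symm⟩
  let b := Module.Free.chooseBasis ℤ N
  have hdvd : ∀ i, d ∣ b.repr u i := fun i => by
    rw [← Ideal.mem_span_singleton, ← hd]
    exact ⟨b.coord i, rfl⟩
  choose c hc using hdvd
  have hunit : IsUnit d := by
    refine hu d (∑ i, c i • b i) ?_
    conv_lhs => rw [← b.sum_repr u]
    rw [Finset.smul_sum]
    exact Finset.sum_congr rfl fun i _ => by rw [hc, mul_smul]
  have h1 : (1 : ℤ) ∈ LinearMap.range (Module.Dual.eval ℤ N u) := by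
    rw [hd, Ideal.span_singleton_eq_top.2 hunit]
    trivial
  obtain ⟨m, hm⟩ := h1
  exact ⟨m, hm⟩

/-- A cone on which all linear forms vanish that vanish at the primitive vector `u` has dimension
at most one. -/
lemma coneDim_le_one {u : N} (hu : IsPrimitive u) {τ : PointedCone ℚ (NQ N)}
    (h : ∀ m : Module.Dual ℤ N, m u = 0 → ∀ v ∈ τ, pairing m v = 0) : coneDim τ ≤ 1 := by
  obtain ⟨m₀, hm₀⟩ := hu.exists_dual_eq_one
  have hle : Submodule.span ℚ (τ : Set (NQ N)) ≤ Submodule.span ℚ {(1 : ℚ) ⊗ₜ[ℤ] u} := by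
    rw [Submodule.span_le]
    intro v hv
    -- Denominators are cleared: `v = x / n` with `x` in the lattice.
    obtain ⟨⟨x, n⟩, hx⟩ := IsLocalizedModule.surj (nonZeroDivisors ℤ)
      (TensorProduct.mk ℤ ℚ N 1) v
    have hn : ((n : ℤ) : ℚ) ≠ 0 := by exact_mod_cast nonZeroDivisors.ne_zero n.2
    have hv' : v = ((n : ℤ) : ℚ)⁻¹ ⊗ₜ[ℤ] x := by
      simp only [TensorProduct.mk_apply, Submonoid.smul_def] at hx
      have h2 : ((n : ℤ) : ℚ) • v = (1 : ℚ) ⊗ₜ[ℤ] x := by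
        rw [← hx, Int.cast_smul_eq_zsmul]
      rw [← inv_smul_smul₀ hn v, h2, TensorProduct.smul_tmul', smul_eq_mul, mul_one]
    -- For every `m` the form `m - m(u) m₀` vanishes at `u`, hence at `x`, so no linear form
    -- separates `x` from `m₀(x) u`.
    have hx0 : x - m₀ x • u = 0 := by
      rw [← Module.forall_dual_apply_eq_zero_iff ℤ]
      intro m
      have := h (m - m u • m₀) (by simp [hm₀]) v hv
      rw [hv', pairing_tmul, mul_eq_zero, or_iff_right (inv_ne_zero hn)] at this
      have h3 : m x - m u * m₀ x = 0 := by exact_mod_cast this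
      simp only [map_sub, map_smul, smul_eq_mul]
      linear_combination h3
    rw [hv', sub_eq_zero.1 hx0, SetLike.mem_coe, Submodule.mem_span_singleton]
    refine ⟨((n : ℤ) : ℚ)⁻¹ * m₀ x, ?_⟩
    rw [TensorProduct.smul_tmul', TensorProduct.tmul_smul, ← Int.cast_smul_eq_zsmul ℚ,
      TensorProduct.smul_tmul']
    simp [mul_comm]
  rw [coneDim]
  refine (Submodule.finrank_mono hle).trans ?_
  simpa using finrank_span_le_card (R := ℚ) {(1 : ℚ) ⊗ₜ[ℤ] u}

end Lattice

/-! ### Values of characters at points of the toric variety, independently of the chart. -/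

section Characters

variable {k : Type*} [Field k] {N : Type*} [AddCommGroup N]

lemma chi_add {σ : PointedCone ℚ (NQ N)} (a b : dualMonoid σ) :
    (chi (a + b) : CoordRing k σ) = chi a * chi b := by
  simp [chi, AddMonoidAlgebra.single_mul_single]

lemma chi_zero {σ : PointedCone ℚ (NQ N)} : (chi 0 : CoordRing k σ) = 1 := rfl

lemma chi_nsmul {σ : PointedCone ℚ (NQ N)} (n : ℕ) (a : dualMonoid σ) :
    (chi (n • a) : CoordRing k σ) = chi a ^ n := by
  simp [chi, AddMonoidAlgebra.single_pow]

lemma incl_chi {σ τ : PointedCone ℚ (NQ N)} (h : τ ≤ σ) (x : AffinePoint k τ) (m : dualMonoid σ) :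
    x.incl h (chi m) = x (chi ⟨m, dualMonoid_anti h m.2⟩) := by
  change x (coordIncl h (chi m)) = _
  congr 1
  simp [coordIncl, chi]
  rfl

/-- The values of the characters of the torus that are defined and invertible at a point. -/
def charGraph {σ : PointedCone ℚ (NQ N)} (y : AffinePoint k σ) : Set (Module.Dual ℤ N × k) :=
  {x | ∃ a b : dualMonoid σ, y (chi a) ≠ 0 ∧ y (chi b) ≠ 0 ∧
    x.1 = (a : Module.Dual ℤ N) - b ∧ x.2 = y (chi a) / y (chi b)}

/-- For a face `τ = σ ∩ m₀^⊥` the character `χ^m₀` is invertible on `U_τ`, and multiplying by a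
power of it moves monomials of `U_τ` into those of `U_σ`. The same power in numerator and
denominator leaves the quotient unchanged. This compatibility with gluing lets characters be
evaluated on `X(Σ)`. -/
lemma charGraph_incl {σ τ : PointedCone ℚ (NQ N)} (h : τ ≤ σ) (hσ : σ.FG) (hf : IsFace τ σ)
    (z : AffinePoint k τ) : charGraph (z.incl h) = charGraph z := by
  ext ⟨m, c⟩
  constructor
  · rintro ⟨a, b, ha, hb, hm, hc⟩
    rw [incl_chi] at ha hb hc
    rw [incl_chi] at hc
    exact ⟨_, _, ha, hb, hm, hc⟩
  · rintro ⟨a, b, ha, hb, hm, hc⟩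
    obtain ⟨m₀, hm₀, hτ⟩ := hf
    obtain ⟨n₁, hn₁⟩ := exists_add_nsmul_mem_dualMonoid hσ hm₀ hτ a.2
    obtain ⟨n₂, hn₂⟩ := exists_add_nsmul_mem_dualMonoid hσ hm₀ hτ b.2
    have hu : m₀ ∈ dualMonoid τ := dualMonoid_anti h hm₀
    have hu' : -m₀ ∈ dualMonoid τ := fun v hv => by
      rw [pairing_neg, ((hτ v).1 hv).2, neg_zero]
    have hz : z (chi ⟨m₀, hu⟩) ≠ 0 := by
      intro h0
      have : z (chi (⟨m₀, hu⟩ + ⟨-m₀, hu'⟩)) = 0 := by rw [chi_add, map_mul, h0, zero_mul]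
      have e : (⟨m₀, hu⟩ + ⟨-m₀, hu'⟩ : dualMonoid τ) = 0 := Subtype.ext (add_neg_cancel m₀)
      rw [e, chi_zero, map_one] at this
      exact one_ne_zero this
    set n := max n₁ n₂
    have key : ∀ (a : dualMonoid τ) (h' : (a : Module.Dual ℤ N) + n • m₀ ∈ dualMonoid σ),
        z.incl h (chi ⟨a + n • m₀, h'⟩) = z (chi a) * z (chi ⟨m₀, hu⟩) ^ n := by
      intro a h'
      rw [incl_chi, ← map_pow, ← map_mul, ← chi_nsmul, ← chi_add]
      rfl
    refine ⟨⟨_, hn₁ n (le_max_left _ _)⟩, ⟨_, hn₂ n (le_max_right _ _)⟩, ?_, ?_, ?_, ?_⟩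
    · rw [key]
      exact mul_ne_zero ha (pow_ne_zero _ hz)
    · rw [key]
      exact mul_ne_zero hb (pow_ne_zero _ hz)
    · simpa using hm
    · rw [key, key, mul_div_mul_right _ _ (pow_ne_zero _ hz)]
      exact hc

variable {F : Fan N}

/-- The character `m` is defined and invertible at `x`, with value `c`. -/
def HasChar (x : ToricVariety k F) (m : Module.Dual ℤ N) (c : k) : Prop :=
  (m, c) ∈ Quot.lift (fun a => charGraph a.2) (fun a b => by
    rintro ⟨z, ha, hb⟩
    rw [ha, hb, charGraph_incl _ (F.polyhedral _ a.1.2) (F.inter_face_left _ a.1.2 _ b.1.2),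
      charGraph_incl _ (F.polyhedral _ b.1.2) (F.inter_face_right _ a.1.2 _ b.1.2)]) x

lemma hasChar_chart_iff {σ : F.cones} {y : AffinePoint k (σ : PointedCone ℚ (NQ N))}
    {m : Module.Dual ℤ N} {c : k} :
    HasChar (chart σ y) m c ↔ ∃ a b : dualMonoid (σ : PointedCone ℚ (NQ N)),
      y (chi a) ≠ 0 ∧ y (chi b) ≠ 0 ∧ m = (a : Module.Dual ℤ N) - b ∧
      c = y (chi a) / y (chi b) := Iff.rfl

lemma exists_eq_chart (x : ToricVariety k F) : ∃ σ y, x = chart (F := F) (k := k) σ y := by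
  obtain ⟨⟨σ, y⟩, rfl⟩ := Quot.exists_rep x
  exact ⟨σ, y, rfl⟩

lemma hasChar_chart {σ : F.cones} {y : AffinePoint k (σ : PointedCone ℚ (NQ N))}
    {m : dualMonoid (σ : PointedCone ℚ (NQ N))} (h : y (chi m) ≠ 0) :
    HasChar (chart σ y) m (y (chi m)) :=
  hasChar_chart_iff.2 ⟨m, 0, h, by simp [chi_zero], by simp, by simp [chi_zero]⟩

lemma HasChar.unique {x : ToricVariety k F} {m : Module.Dual ℤ N} {c c' : k}
    (h : HasChar x m c) (h' : HasChar x m c') : c = c' := by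
  obtain ⟨σ, y, rfl⟩ := exists_eq_chart x
  obtain ⟨a, b, ha, hb, rfl, rfl⟩ := hasChar_chart_iff.1 h
  obtain ⟨a', b', ha', hb', he, rfl⟩ := hasChar_chart_iff.1 h'
  rw [div_eq_div_iff hb hb', ← map_mul, ← map_mul, ← chi_add, ← chi_add]
  congr 2
  exact Subtype.ext (sub_eq_sub_iff_add_eq_add.1 he)

lemma HasChar.ne_zero {x : ToricVariety k F} {m : Module.Dual ℤ N} {c : k} (h : HasChar x m c) :
    c ≠ 0 := by
  obtain ⟨σ, y, rfl⟩ := exists_eq_chart x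
  obtain ⟨a, b, ha, hb, -, rfl⟩ := hasChar_chart_iff.1 h
  exact div_ne_zero ha hb

lemma HasChar.add {x : ToricVariety k F} {m m' : Module.Dual ℤ N} {c c' : k}
    (h : HasChar x m c) (h' : HasChar x m' c') : HasChar x (m + m') (c * c') := by
  obtain ⟨σ, y, rfl⟩ := exists_eq_chart x
  obtain ⟨a, b, ha, hb, rfl, rfl⟩ := hasChar_chart_iff.1 h
  obtain ⟨a', b', ha', hb', rfl, rfl⟩ := hasChar_chart_iff.1 h'
  refine hasChar_chart_iff.2 ⟨a + a', b + b', ?_, ?_, ?_, ?_⟩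
  · rw [chi_add, map_mul]
    exact mul_ne_zero ha ha'
  · rw [chi_add, map_mul]
    exact mul_ne_zero hb hb'
  · simp only [AddSubmonoid.coe_add]
    abel
  · rw [chi_add, chi_add, map_mul, map_mul, div_mul_div_comm]

lemma HasChar.smul {x : ToricVariety k F} {m : Module.Dual ℤ N} {c : k} (h : HasChar x m c)
    (g : Torus k N) : HasChar (g • x) m ((g (Multiplicative.ofAdd m) : k) * c) := by
  obtain ⟨σ, y, rfl⟩ := exists_eq_chart x
  obtain ⟨a, b, ha, hb, rfl, rfl⟩ := hasChar_chart_iff.1 h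
  rw [smul_chart]
  refine hasChar_chart_iff.2 ⟨a, b, ?_, ?_, rfl, ?_⟩
  · rw [smul_affine_chi]
    exact mul_ne_zero (Units.ne_zero _) ha
  · rw [smul_affine_chi]
    exact mul_ne_zero (Units.ne_zero _) hb
  · rw [smul_affine_chi, smul_affine_chi, ofAdd_sub, map_div, Units.val_div_eq_div_val,
      div_mul_div_comm]

/-- On the orbit of `τ` a nonvanishing monomial has exponent in `τ^⊥`, hence so has a quotient of
two such. This bounds the strata that a line can meet. -/
lemma HasChar.eq_zero_of_mem_orbit {x : ToricVariety k F} {m : Module.Dual ℤ N} {c : k}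
    (h : HasChar x m c) {τ : F.cones} (hx : x ∈ orbit k F τ) {v : NQ N}
    (hv : v ∈ (τ : PointedCone ℚ (NQ N))) : pairing m v = 0 := by
  obtain ⟨y, rfl, hy⟩ := hx
  obtain ⟨a, b, ha, hb, rfl, rfl⟩ := hasChar_chart_iff.1 h
  have h1 := (hy a).1 ha v hv
  have h2 := (hy b).1 hb v hv
  rw [sub_eq_add_neg, pairing_add, pairing_neg, h1, h2]
  simp

open Classical in
/-- The value of the character `m` at `x`, provided it is defined and invertible there. -/
def charVal (x : ToricVariety k F) (m : Module.Dual ℤ N) : k :=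
  if h : ∃ c, HasChar x m c then h.choose else 0

lemma HasChar.charVal_eq {x : ToricVariety k F} {m : Module.Dual ℤ N} {c : k}
    (h : HasChar x m c) : charVal x m = c := by
  have he : ∃ c, HasChar x m c := ⟨c, h⟩
  rw [charVal, dif_pos he]
  exact he.choose_spec.unique h

lemma mem_bigTorus_iff {x : ToricVariety k F} :
    x ∈ bigTorus k F ↔ ∃ y : AffinePoint k (⊥ : PointedCone ℚ (NQ N)),
      x = chart ⟨⊥, F.zero_mem⟩ y ∧ ∀ m, y (chi m) ≠ 0 := by
  have h0 : ∀ m : Module.Dual ℤ N, ∀ v ∈ (⊥ : PointedCone ℚ (NQ N)), pairing m v = 0 := by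
    intro m v hv
    rw [(Submodule.mem_bot _).1 hv, map_zero]
  constructor
  · rintro ⟨y, rfl, hy⟩
    exact ⟨y, rfl, fun m => (hy m).2 (h0 m)⟩
  · rintro ⟨y, rfl, hy⟩
    exact ⟨y, rfl, fun m => ⟨fun _ => h0 m, fun _ => hy m⟩⟩

lemma hasChar_of_mem_bigTorus {x : ToricVariety k F} (hx : x ∈ bigTorus k F)
    (m : Module.Dual ℤ N) : HasChar x m (charVal x m) := by
  obtain ⟨y, rfl, hy⟩ := mem_bigTorus_iff.1 hx
  have := hasChar_chart (σ := ⟨⊥, F.zero_mem⟩) (hy ⟨m, mem_dualMonoid_bot m⟩)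
  rw [this.charVal_eq]
  exact this

/-- On the big torus `-m` too is an invertible character, so `-m = a - b` with `χ^a`, `χ^b` nonzero
at `y`. Then `b = m + a`, and `χ^m` divides `χ^b`. -/
lemma chart_chi_ne_zero {σ : F.cones} {y : AffinePoint k (σ : PointedCone ℚ (NQ N))}
    (h : chart σ y ∈ bigTorus k F) (m : dualMonoid (σ : PointedCone ℚ (NQ N))) :
    y (chi m) ≠ 0 := by
  obtain ⟨a, b, ha, hb, he, -⟩ := hasChar_chart_iff.1 (hasChar_of_mem_bigTorus h (-m))
  intro h0
  have hab : b = m + a := Subtype.ext (by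
    rw [AddSubmonoid.coe_add, ← sub_eq_iff_eq_add, ← neg_sub, ← he, neg_neg])
  rw [hab, chi_add, map_mul, h0, zero_mul] at hb
  exact hb rfl

lemma charVal_chart {σ : F.cones} {y : AffinePoint k (σ : PointedCone ℚ (NQ N))}
    (h : chart σ y ∈ bigTorus k F) (m : dualMonoid (σ : PointedCone ℚ (NQ N))) :
    charVal (chart σ y) m = y (chi m) :=
  (hasChar_chart (chart_chi_ne_zero h m)).charVal_eq

lemma charVal_ne_zero {x : ToricVariety k F} (hx : x ∈ bigTorus k F) (m : Module.Dual ℤ N) :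
    charVal x m ≠ 0 := (hasChar_of_mem_bigTorus hx m).ne_zero

lemma charVal_add {x : ToricVariety k F} (hx : x ∈ bigTorus k F) (m m' : Module.Dual ℤ N) :
    charVal x (m + m') = charVal x m * charVal x m' :=
  ((hasChar_of_mem_bigTorus hx m).add (hasChar_of_mem_bigTorus hx m')).charVal_eq

lemma charVal_smul {x : ToricVariety k F} (hx : x ∈ bigTorus k F) (g : Torus k N)
    (m : Module.Dual ℤ N) :
    charVal (g • x) m = (g (Multiplicative.ofAdd m) : k) * charVal x m :=
  ((hasChar_of_mem_bigTorus hx m).smul g).charVal_eq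

/-- Evaluation of characters at a point of the big torus. -/
def charHom (x : ToricVariety k F) (hx : x ∈ bigTorus k F) :
    Multiplicative (Module.Dual ℤ N) →* kˣ :=
  MonoidHom.mk' (fun m => Units.mk0 (charVal x m.toAdd) (charVal_ne_zero hx _)) fun a b => by
    ext
    exact charVal_add hx _ _

lemma charHom_apply {x : ToricVariety k F} (hx : x ∈ bigTorus k F) (m : Module.Dual ℤ N) :
    (charHom x hx (Multiplicative.ofAdd m) : k) = charVal x m := rfl

lemma charVal_zsmul {x : ToricVariety k F} (hx : x ∈ bigTorus k F) (n : ℤ)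
    (m : Module.Dual ℤ N) : charVal x (n • m) = charVal x m ^ n := by
  rw [← charHom_apply hx, ← charHom_apply hx, ofAdd_zsmul, map_zpow, Units.val_zpow_eq_zpow_val]

lemma eq_of_charVal_eq {x x' : ToricVariety k F} (hx : x ∈ bigTorus k F)
    (hx' : x' ∈ bigTorus k F) (h : ∀ m, charVal x m = charVal x' m) : x = x' := by
  obtain ⟨y, rfl, hy⟩ := mem_bigTorus_iff.1 hx
  obtain ⟨y', rfl, hy'⟩ := mem_bigTorus_iff.1 hx'
  congr 1
  refine coordRing_hom_ext fun m => ?_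
  rw [← charVal_chart hx, ← charVal_chart hx', h]

lemma smul_mem_bigTorus {x : ToricVariety k F} (hx : x ∈ bigTorus k F) (g : Torus k N) :
    g • x ∈ bigTorus k F := smul_mem_orbit g hx

lemma chart_incl {σ τ : F.cones} (h : (τ : PointedCone ℚ (NQ N)) ≤ σ)
    (y : AffinePoint k (τ : PointedCone ℚ (NQ N))) : chart σ (y.incl h) = chart τ y := by
  refine Quot.sound ⟨y.incl (le_inf h le_rfl), ?_, ?_⟩ <;>
  · refine coordRing_hom_ext fun m => ?_
    simp only [incl_chi]

end Characters

/-! ### Orders of functions at points, disregarding values on a finite set. -/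

section Germs

open MvPolynomial

variable {k : Type*} [Field k]

/-- Off the zeros of `s` and near `p`, the function `f` is the `n`-th power of the linear form `l`
times a nowhere vanishing quotient of forms. -/
def HasGerm (s l : MvPolynomial (Fin 2) k) (p : P1 k) (f : P1 k → k) (n : ℤ) : Prop :=
  ∃ (d e : ℕ) (A B : MvPolynomial (Fin 2) k), A.IsHomogeneous d ∧ B.IsHomogeneous e ∧
    (d : ℤ) + n = e ∧ formVal A p ≠ 0 ∧ formVal B p ≠ 0 ∧
    ∀ q, formVal s q ≠ 0 → formVal A q ≠ 0 → formVal B q ≠ 0 →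
      f q = formVal l q ^ n * formVal A q / formVal B q

variable {s l : MvPolynomial (Fin 2) k} {p : P1 k}

lemma HasGerm.inv {f : P1 k → k} {n : ℤ} (h : HasGerm s l p f n) :
    HasGerm s l p (fun q => (f q)⁻¹) (-n) := by
  obtain ⟨d, e, A, B, hA, hB, hd, hAp, hBp, hf⟩ := h
  refine ⟨e, d, B, A, hB, hA, by omega, hBp, hAp, fun q hs hBq hAq => ?_⟩
  simp only [hf q hs hAq hBq, inv_div, zpow_neg]
  rw [mul_comm (formVal l q ^ n), div_mul_eq_div_div, div_eq_mul_inv _ (formVal l q ^ n), mul_comm,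
    mul_div_assoc]

lemma HasGerm.mul (hl : ∀ q, formVal s q ≠ 0 → formVal l q ≠ 0) {f g : P1 k → k} {m n : ℤ}
    (hf : HasGerm s l p f m) (hg : HasGerm s l p g n) :
    HasGerm s l p (fun q => f q * g q) (m + n) := by
  obtain ⟨d, e, A, B, hA, hB, hd, hAp, hBp, hf⟩ := hf
  obtain ⟨d', e', A', B', hA', hB', hd', hAp', hBp', hg⟩ := hg
  refine ⟨d + d', e + e', A * A', B * B', hA.mul hA', hB.mul hB', by push_cast; omega, ?_, ?_,
    fun q hs hAq hBq => ?_⟩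
  · rw [formVal_mul]
    exact mul_ne_zero hAp hAp'
  · rw [formVal_mul]
    exact mul_ne_zero hBp hBp'
  · rw [formVal_mul] at hAq hBq
    beta_reduce
    rw [hf q hs (left_ne_zero_of_mul hAq) (left_ne_zero_of_mul hBq),
      hg q hs (right_ne_zero_of_mul hAq) (right_ne_zero_of_mul hBq), formVal_mul, formVal_mul,
      zpow_add₀ (hl q hs), div_mul_div_comm, mul_mul_mul_comm]

lemma HasGerm.one : HasGerm s l p (fun _ => 1) 0 :=
  ⟨0, 0, 1, 1, isHomogeneous_one _ _, isHomogeneous_one _ _, by simp, by simp, by simp, by simp⟩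

lemma HasGerm.pow (hl : ∀ q, formVal s q ≠ 0 → formVal l q ≠ 0) {f : P1 k → k} {m : ℤ}
    (hf : HasGerm s l p f m) (n : ℕ) : HasGerm s l p (fun q => f q ^ n) (n * m) := by
  induction n with
  | zero => simpa using HasGerm.one
  | succ n ih =>
    have := ih.mul hl hf
    simp only [← pow_succ] at this
    convert this using 1
    push_cast
    ring

lemma HasGerm.zpow (hl : ∀ q, formVal s q ≠ 0 → formVal l q ≠ 0) {f : P1 k → k} {m : ℤ}
    (hf : HasGerm s l p f m) (n : ℤ) : HasGerm s l p (fun q => f q ^ n) (n * m) := by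
  obtain ⟨n, rfl | rfl⟩ := n.eq_nat_or_neg
  · simpa using hf.pow hl n
  · simpa using (hf.pow hl n).inv

lemma HasGerm.div (hl : ∀ q, formVal s q ≠ 0 → formVal l q ≠ 0) {f g : P1 k → k} {m n : ℤ}
    (hf : HasGerm s l p f m) (hg : HasGerm s l p g n) :
    HasGerm s l p (fun q => f q / g q) (m - n) := by
  simpa [div_eq_mul_inv, sub_eq_add_neg] using hf.mul hl hg.inv

/-- Numerator and denominator are multiplied by a form that is nonzero at `p` and vanishes outside
`V`, which confines the formula to `V`. -/
lemma HasGerm.congr {V : Set (P1 k)} (hV : IsZariskiOpen V) (hp : p ∈ V) {f g : P1 k → k} {n : ℤ}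
    (hf : HasGerm s l p f n) (h : ∀ q ∈ V, formVal s q ≠ 0 → g q = f q) : HasGerm s l p g n := by
  obtain ⟨d, e, A, B, hA, hB, hd, hAp, hBp, hf⟩ := hf
  obtain ⟨c, v, hv, hvp, hvV⟩ := hV p hp
  refine ⟨d + c, e + c, A * v, B * v, hA.mul hv, hB.mul hv, by push_cast; omega, ?_, ?_,
    fun q hs hAq hBq => ?_⟩
  · rw [formVal_mul]
    exact mul_ne_zero hAp hvp
  · rw [formVal_mul]
    exact mul_ne_zero hBp hvp
  · rw [formVal_mul] at hAq hBq
    have hvq := right_ne_zero_of_mul hAq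
    rw [h q (hvV q hvq) hs, hf q hs (left_ne_zero_of_mul hAq) (left_ne_zero_of_mul hBq),
      formVal_mul, formVal_mul, ← mul_assoc, mul_div_mul_right _ _ hvq]

lemma hasGerm_of_isRegularOn {V : Set (P1 k)} (hV : IsZariskiOpen V) (hp : p ∈ V) {f : P1 k → k}
    (hf : IsRegularOn V f) (h0 : f p ≠ 0) : HasGerm s l p f 0 := by
  obtain ⟨d, a, b, ha, hb, hbp, hab⟩ := hf p hp
  have hap : formVal a p ≠ 0 := by
    intro h
    rw [hab p hp hbp, h, zero_div] at h0
    exact h0 rfl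
  obtain ⟨c, v, hv, hvp, hvV⟩ := hV p hp
  refine ⟨d + c, d + c, a * v, b * v, ha.mul hv, hb.mul hv, by simp, ?_, ?_, fun q _ _ hq => ?_⟩
  · rw [formVal_mul]
    exact mul_ne_zero hap hvp
  · rw [formVal_mul]
    exact mul_ne_zero hbp hvp
  · rw [formVal_mul] at hq
    have hvq := right_ne_zero_of_mul hq
    rw [hab q (hvV q hvq) (left_ne_zero_of_mul hq), formVal_mul, formVal_mul, zpow_zero, one_mul,
      mul_div_mul_right _ _ hvq]

lemma HasOrderAt.hasGerm {f : P1 k → k} {w : ℕ} (h : HasOrderAt f p w) :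
    HasGerm s (linForm p) p f w := by
  obtain ⟨d, l, a, b, hl, hl0, hlp, ha, hb, hap, hbp, hf⟩ := h
  obtain ⟨c, hc, hlc⟩ := exists_formVal_eq_const_mul_linForm hl hl0 hlp
  refine ⟨d, d + w, C (c ^ w) * a, b, by simpa using ha.C_mul (c ^ w), hb, by simp, ?_, hbp,
    fun q _ _ hbq => ?_⟩
  · rw [formVal_mul, formVal_C]
    exact mul_ne_zero (pow_ne_zero _ hc) hap
  · rw [hf q hbq, hlc, formVal_mul, formVal_C, zpow_natCast]
    ring

/-- A function that is everywhere locally a nowhere vanishing quotient of forms is constant. -/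
lemma exists_eq_const_of_hasGerm [IsAlgClosed k] {e : ℕ} (hs : s.IsHomogeneous e) (hs0 : s ≠ 0)
    {f : P1 k → k} (H : ∀ p, ∃ l, HasGerm s l p f 0) : ∃ c, ∀ q, formVal s q ≠ 0 → f q = c := by
  refine exists_eq_const_of_locally_quotient hs hs0 f fun p => ?_
  obtain ⟨l, d, e, A, B, hA, hB, hd, hAp, hBp, hf⟩ := H p
  obtain rfl : d = e := by omega
  -- The extra factor `A` ensures that a nonvanishing denominator also gives `A ≠ 0` at `q`, as the
  -- formula of the germ requires.
  refine ⟨d + d, A * A, B * A, hA.mul hA, hB.mul hA, ?_, fun q hs hq => ?_⟩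
  · rw [formVal_mul]
    exact mul_ne_zero hBp hAp
  · rw [formVal_mul] at hq
    have hAq := right_ne_zero_of_mul hq
    rw [hf q hs hAq (left_ne_zero_of_mul hq), formVal_mul, formVal_mul, zpow_zero, one_mul,
      mul_div_mul_right _ _ hAq]

/-- Regular functions that agree off finitely many points agree. -/
lemma eq_of_isRegularOn [Infinite k] {e : ℕ} (hs : s.IsHomogeneous e) (hs0 : s ≠ 0)
    {V V' : Set (P1 k)} (hV : IsZariskiOpen V) (hV' : IsZariskiOpen V') (hp : p ∈ V)
    (hp' : p ∈ V') {f f' : P1 k → k} (hf : IsRegularOn V f) (hf' : IsRegularOn V' f')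
    (h : ∀ q ∈ V, q ∈ V' → formVal s q ≠ 0 → f q = f' q) : f p = f' p := by
  obtain ⟨d, a, b, ha, hb, hbp, hab⟩ := hf p hp
  obtain ⟨d', a', b', ha', hb', hbp', hab'⟩ := hf' p hp'
  obtain ⟨c, v, hv, hvp, hvV⟩ := hV p hp
  obtain ⟨c', v', hv', hvp', hvV'⟩ := hV' p hp'
  -- The cross-multiplied difference vanishes wherever `s`, both denominators and the forms cutting
  -- down to `V` and `V'` do not.
  have hz : a * b' - a' * b = 0 := by
    refine eq_zero_of_formVal_eq_zero ((ha.mul hb').sub (by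
        have := ha'.mul hb
        rwa [add_comm] at this))
      ((((hs.mul hb).mul hb').mul hv).mul hv') ?_ fun q hq => ?_
    · exact mul_ne_zero (mul_ne_zero (mul_ne_zero (mul_ne_zero hs0
        (ne_zero_of_formVal_ne_zero hbp)) (ne_zero_of_formVal_ne_zero hbp'))
        (ne_zero_of_formVal_ne_zero hvp)) (ne_zero_of_formVal_ne_zero hvp')
    · simp only [formVal_mul, mul_ne_zero_iff] at hq
      obtain ⟨⟨⟨⟨hsq, hbq⟩, hbq'⟩, hvq⟩, hvq'⟩ := hq
      have := h q (hvV q hvq) (hvV' q hvq') hsq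
      rw [hab q (hvV q hvq) hbq, hab' q (hvV' q hvq') hbq', div_eq_div_iff hbq hbq'] at this
      rw [formVal_sub, formVal_mul, formVal_mul, this, sub_self]
  rw [hab p hp hbp, hab' p hp' hbp', div_eq_div_iff hbp hbp', ← formVal_mul, ← formVal_mul,
    sub_eq_zero.1 hz]

/-- The form with simple zeros at the points `p i`. -/
def divForm {a : ℕ} (p : Fin a → P1 k) : MvPolynomial (Fin 2) k := ∏ i, linForm (p i)

lemma isHomogeneous_divForm {a : ℕ} (p : Fin a → P1 k) : (divForm p).IsHomogeneous a := by
  have := IsHomogeneous.prod Finset.univ (fun i => linForm (p i)) (fun _ => 1)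
    fun _ _ => isHomogeneous_linForm _
  simpa [divForm] using this

lemma divForm_ne_zero {a : ℕ} (p : Fin a → P1 k) : divForm p ≠ 0 :=
  Finset.prod_ne_zero_iff.2 fun _ _ => linForm_ne_zero _

lemma formVal_divForm_ne_zero_iff {a : ℕ} {p : Fin a → P1 k} {q : P1 k} :
    formVal (divForm p) q ≠ 0 ↔ q ∉ Set.range p := by
  rw [divForm, formVal_prod, Finset.prod_ne_zero_iff]
  simp [formVal_linForm_eq_zero_iff, eq_comm (a := q)]

end Germs

/-! ### Orders of characters along a line, and uniqueness up to the torus. -/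

section Proportional

variable {k : Type*} [Field k] {N : Type*} [AddCommGroup N] {F : Fan N}

lemma IsLocalMorphism.comp_smul (e : (Fin 2 → k) ≃ₗ[k] (Fin 2 → k)) {φ : P1 k → ToricVariety k F}
    {V : Set (P1 k)} {σ : F.cones} {ψ : P1 k → AffinePoint k (σ : PointedCone ℚ (NQ N))}
    (h : IsLocalMorphism φ V σ ψ) :
    IsLocalMorphism (fun q => φ (e • q)) ((fun q => e • q) ⁻¹' V) σ (fun q => ψ (e • q)) where
  isOpen := (isP1Morphism_smul e V h.isOpen).1
  eq_chart _ hq := h.eq_chart _ hq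
  regular f := (isP1Morphism_smul e V h.isOpen).2 _ (h.regular f)

lemma MeetsDivisorWithMult.comp_smul {e : (Fin 2 → k) ≃ₗ[k] (Fin 2 → k)}
    {φ : P1 k → ToricVariety k F} {p : P1 k} {u : N} {w : ℕ}
    (h : MeetsDivisorWithMult φ (e • p) u w) :
    MeetsDivisorWithMult (fun q => φ (e • q)) p u w := by
  obtain ⟨hu, hp, V, ψ, hpV, hψ, m, hm, ho⟩ := h
  exact ⟨hu, hp, _, _, hpV, hψ.comp_smul e, m, hm, ho.comp_smul⟩

/-- The map `φ` is a morphism that meets the boundary exactly at the points `p i`, and there in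
the divisors of the `u i` with multiplicities `w i`. -/
structure IsLineThrough {a : ℕ} (p : Fin a → P1 k) (u : Fin a → N) (w : Fin a → ℕ)
    (φ : P1 k → ToricVariety k F) : Prop where
  morphism : IsMorphism φ
  range_eq : Set.range p = φ ⁻¹' boundary k F
  meets : ∀ i, MeetsDivisorWithMult φ (p i) (u i) (w i)

variable {a : ℕ} {p : Fin a → P1 k} {u : Fin a → N} {w : Fin a → ℕ} {φ φ' : P1 k → ToricVariety k F}

lemma IsLineThrough.comp_smul {e : (Fin 2 → k) ≃ₗ[k] (Fin 2 → k)}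
    (h : IsLineThrough (fun i => e • p i) u w φ) : IsLineThrough p u w (fun q => φ (e • q)) where
  morphism q := by
    obtain ⟨V, σ, ψ, hp, hψ⟩ := h.morphism (e • q)
    exact ⟨_, σ, _, hp, hψ.comp_smul e⟩
  range_eq := by
    ext q
    have := Set.ext_iff.1 h.range_eq (e • q)
    simp only [Set.mem_range, Set.mem_preimage, smul_left_cancel_iff] at this
    exact this
  meets i := (h.meets i).comp_smul

lemma IsLineThrough.mem_bigTorus_iff (h : IsLineThrough p u w φ) {q : P1 k} :
    φ q ∈ bigTorus k F ↔ formVal (divForm p) q ≠ 0 := by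
  rw [formVal_divForm_ne_zero_iff, h.range_eq, Set.mem_preimage, boundary, Set.mem_compl_iff,
    not_not]

/-- Off the boundary points the characters are regular and invertible along a line. -/
lemma IsLineThrough.hasGerm_of_notMem (h : IsLineThrough p u w φ) (m : Module.Dual ℤ N) {q₀ : P1 k}
    (hq₀ : formVal (divForm p) q₀ ≠ 0) :
    HasGerm (divForm p) 1 q₀ (fun q => charVal (φ q) m) 0 := by
  obtain ⟨V, σ, ψ, hV, hψ⟩ := h.morphism q₀
  have hbig := h.mem_bigTorus_iff.2 hq₀
  have hc := hasChar_of_mem_bigTorus hbig m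
  rw [hψ.eq_chart q₀ hV] at hbig hc
  obtain ⟨a, b, ha, hb, rfl, -⟩ := hasChar_chart_iff.1 hc
  have hga := hasGerm_of_isRegularOn (s := divForm p) (l := 1) hψ.isOpen hV (hψ.regular (chi a)) ha
  have hgb := hasGerm_of_isRegularOn (s := divForm p) (l := 1) hψ.isOpen hV (hψ.regular (chi b)) hb
  have := hga.div (fun q _ => by simp) hgb
  rw [sub_zero] at this
  refine this.congr hψ.isOpen hV fun q hq hs => ?_
  have hbq := h.mem_bigTorus_iff.2 hs
  rw [hψ.eq_chart q hq] at hbq ⊢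
  exact (hasChar_chart_iff.2 ⟨a, b, chart_chi_ne_zero hbq a, chart_chi_ne_zero hbq b, rfl,
    rfl⟩).charVal_eq

/-- The order of a character at a boundary point of a line. -/
lemma IsLineThrough.hasGerm_boundary (h : IsLineThrough p u w φ) (m : Module.Dual ℤ N) (i : Fin a) :
    HasGerm (divForm p) (linForm (p i)) (p i) (fun q => charVal (φ q) m) (m (u i) * w i) := by
  obtain ⟨hu, -, V, ψ, hV, hψ, m₀, hm₀, ho⟩ := h.meets i
  have hl : ∀ q, formVal (divForm p) q ≠ 0 → formVal (linForm (p i)) q ≠ 0 := by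
    intro q hq h0
    rw [formVal_divForm_ne_zero_iff] at hq
    exact hq ⟨i, (formVal_linForm_eq_zero_iff.1 h0).symm⟩
  -- The part of `m` orthogonal to `u i`: both `m'` and `-m'` are in the dual monoid of the ray, so
  -- `χ^m'` is invertible at `p i` and the order comes from `χ^m₀` alone.
  let m' : Module.Dual ℤ N := m - m (u i) • (m₀ : Module.Dual ℤ N)
  have hm'u : m' (u i) = 0 := by simp [m', hm₀]
  have hm' : m' ∈ dualMonoid (ray (u i)) := mem_dualMonoid_ray_iff.2 hm'u.ge
  have hn' : -m' ∈ dualMonoid (ray (u i)) := mem_dualMonoid_ray_iff.2 (by simp [hm'u])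
  have hne : ψ (p i) (chi ⟨m', hm'⟩) ≠ 0 := by
    intro h0
    have h1 : ψ (p i) (chi (⟨m', hm'⟩ + ⟨-m', hn'⟩)) = 0 := by
      rw [chi_add, map_mul, h0, zero_mul]
    have h2 : (⟨m', hm'⟩ + ⟨-m', hn'⟩ : dualMonoid (ray (u i))) = 0 :=
      Subtype.ext (add_neg_cancel m')
    rw [h2, chi_zero, map_one] at h1
    exact one_ne_zero h1
  have hg₀ : HasGerm (divForm p) (linForm (p i)) (p i) (fun q => ψ q (chi m₀)) (w i) := ho.hasGerm
  have hg' := hasGerm_of_isRegularOn (s := divForm p) (l := linForm (p i)) hψ.isOpen hV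
    (hψ.regular (chi ⟨m', hm'⟩)) hne
  have := (hg₀.zpow hl (m (u i))).mul hl hg'
  rw [add_zero] at this
  refine this.congr hψ.isOpen hV fun q hq hs => ?_
  have hbq := h.mem_bigTorus_iff.2 hs
  rw [hψ.eq_chart q hq] at hbq ⊢
  have hm : m = m (u i) • (m₀ : Module.Dual ℤ N) + m' := by simp [m']
  conv_lhs => rw [hm]
  rw [charVal_add hbq, charVal_zsmul hbq, charVal_chart hbq]
  congr 1
  exact charVal_chart hbq ⟨m', hm'⟩

/-- Two lines with the same behaviour at the boundary differ by an element of the torus. -/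
theorem IsLineThrough.exists_smul_eq [IsAlgClosed k] (h : IsLineThrough p u w φ)
    (h' : IsLineThrough p u w φ') : ∃ g : Torus k N, ∀ q, φ' q = g • φ q := by
  have hinf : Infinite k := IsAlgClosed.instInfinite
  have hs := isHomogeneous_divForm p
  have hs0 := divForm_ne_zero p
  obtain ⟨q₀, hq₀⟩ := exists_formVal_ne_zero hs hs0
  have hb := h.mem_bigTorus_iff.2 hq₀
  have hb' := h'.mem_bigTorus_iff.2 hq₀
  -- The only candidate: the element carrying `φ q₀` to `φ' q₀` at one base point.
  let g : Torus k N := (charHom (φ' q₀) hb' / charHom (φ q₀) hb :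
    Multiplicative (Module.Dual ℤ N) →* kˣ)
  have hg : ∀ m, (g (Multiplicative.ofAdd m) : k) = charVal (φ' q₀) m / charVal (φ q₀) m := by
    intro m
    change ((charHom (φ' q₀) hb' (Multiplicative.ofAdd m) /
      charHom (φ q₀) hb (Multiplicative.ofAdd m) : kˣ) : k) = _
    rw [Units.val_div_eq_div_val, charHom_apply, charHom_apply]
  have hconst : ∀ m q, formVal (divForm p) q ≠ 0 →
      charVal (φ' q) m = (g (Multiplicative.ofAdd m) : k) * charVal (φ q) m := by
    intro m
    -- At `p i` both characters have order `m (u i) * w i`, so their quotient has order zero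
    -- everywhere.
    obtain ⟨c, hc⟩ := exists_eq_const_of_hasGerm hs hs0
      (f := fun q => charVal (φ' q) m / charVal (φ q) m) fun q => by
        by_cases hq : q ∈ Set.range p
        · obtain ⟨i, rfl⟩ := hq
          refine ⟨linForm (p i), ?_⟩
          have := (h'.hasGerm_boundary m i).div (fun q hq h0 => by
            rw [formVal_divForm_ne_zero_iff] at hq
            exact hq ⟨i, (formVal_linForm_eq_zero_iff.1 h0).symm⟩) (h.hasGerm_boundary m i)
          rwa [sub_self] at this
        · rw [← formVal_divForm_ne_zero_iff] at hq
          exact ⟨1, by simpa using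
            (h'.hasGerm_of_notMem m hq).div (fun q _ => by simp) (h.hasGerm_of_notMem m hq)⟩
    intro q hq
    have h1 := hc q hq
    rw [hg, hc q₀ hq₀, ← h1, div_mul_cancel₀ _ (charVal_ne_zero (h.mem_bigTorus_iff.2 hq) m)]
  refine ⟨g, fun q => ?_⟩
  by_cases hq : q ∈ Set.range p
  · obtain ⟨i, rfl⟩ := hq
    obtain ⟨hu, -, V, ψ, hV, hψ, -⟩ := h.meets i
    obtain ⟨hu', -, V', ψ', hV', hψ', -⟩ := h'.meets i
    have hgψ := hψ.smul g
    rw [hψ'.eq_chart _ hV', hψ.eq_chart _ hV, smul_chart]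
    congr 1
    -- At a boundary point both lines lie in the same chart, and equality of the regular functions
    -- `χ^m` extends from the complement of the boundary points.
    refine coordRing_hom_ext fun m => ?_
    refine eq_of_isRegularOn (f := fun q => ψ' q (chi m)) (f' := fun q => (g • ψ q) (chi m)) hs hs0
      hψ'.isOpen hψ.isOpen hV' hV (hψ'.regular (chi m)) (hgψ.regular (chi m)) fun q hq' hq hsq => ?_
    have hbq := h.mem_bigTorus_iff.2 hsq
    have hbq' := h'.mem_bigTorus_iff.2 hsq
    have := hconst m q hsq
    rw [hψ.eq_chart q hq] at hbq this
    rw [hψ'.eq_chart q hq'] at hbq' this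
    rw [charVal_chart hbq, charVal_chart hbq'] at this
    rw [smul_affine_chi]
    exact this
  · rw [← formVal_divForm_ne_zero_iff] at hq
    have hbq := h.mem_bigTorus_iff.2 hq
    refine eq_of_charVal_eq (h'.mem_bigTorus_iff.2 hq) (smul_mem_bigTorus hbq g) fun m => ?_
    rw [hconst m q hq, charVal_smul hbq]

end Proportional

/-! ### Closure properties of regular functions. -/

section Regular

open MvPolynomial

variable {k : Type*} [Field k] {V : Set (P1 k)}

lemma IsRegularOn.add {f g : P1 k → k} (hf : IsRegularOn V f) (hg : IsRegularOn V g) :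
    IsRegularOn V (fun q => f q + g q) := by
  intro p hp
  obtain ⟨d, a, b, ha, hb, hbp, hab⟩ := hf p hp
  obtain ⟨d', a', b', ha', hb', hbp', hab'⟩ := hg p hp
  refine ⟨d + d', a * b' + b * a', b * b', (ha.mul hb').add (hb.mul ha'), hb.mul hb', ?_,
    fun q hq hbq => ?_⟩
  · rw [formVal_mul]
    exact mul_ne_zero hbp hbp'
  · rw [formVal_mul] at hbq
    beta_reduce
    rw [hab q hq (left_ne_zero_of_mul hbq), hab' q hq (right_ne_zero_of_mul hbq), formVal_add,
      formVal_mul, formVal_mul, formVal_mul,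
      div_add_div _ _ (left_ne_zero_of_mul hbq) (right_ne_zero_of_mul hbq)]

lemma IsRegularOn.const_mul {f : P1 k → k} (hf : IsRegularOn V f) (c : k) :
    IsRegularOn V (fun q => c * f q) := by
  intro p hp
  obtain ⟨d, a, b, ha, hb, hbp, hab⟩ := hf p hp
  refine ⟨d, C c * a, b, by simpa using ha.C_mul c, hb, hbp, fun q hq hbq => ?_⟩
  beta_reduce
  rw [hab q hq hbq, formVal_mul, formVal_C, mul_div_assoc]

lemma isRegularOn_zero : IsRegularOn V (fun _ => 0) := fun _ _ =>
  ⟨0, 0, 1, isHomogeneous_zero _ _ _, isHomogeneous_one _ _, by simp, by simp [formVal]⟩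

/-- Regularity of a family of points of an affine toric variety can be checked on monomials. -/
lemma isRegularOn_of_chi {N : Type*} [AddCommGroup N] {σ : PointedCone ℚ (NQ N)}
    {ψ : P1 k → AffinePoint k σ} (h : ∀ m, IsRegularOn V (fun q => ψ q (chi m)))
    (f : CoordRing k σ) : IsRegularOn V (fun q => ψ q f) := by
  induction f using AddMonoidAlgebra.induction_linear with
  | zero => simpa using isRegularOn_zero
  | add f g hf hg => simpa using hf.add hg
  | single m c =>
    have hc : (AddMonoidAlgebra.single m c : CoordRing k σ) = c • chi m := by
      simp [chi]
    simpa [hc] using (h m).const_mul c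

end Regular

/-! ### Existence: lines given by products of powers of linear forms. -/

section StandardLine

open MvPolynomial

variable {k : Type*} [Field k] {N : Type*} [AddCommGroup N]

/-- The monomial `∏ c_j ^ (w_j ⟨m, u_j⟩)`. -/
def monVal {a : ℕ} (u : Fin a → N) (w : Fin a → ℕ) (c : Fin a → k) (m : Module.Dual ℤ N) : k :=
  ∏ j, c j ^ ((w j : ℤ) * m (u j))

open Classical in
/-- The point of `U_σ` at which the monomials take the values `monVal u w c m`; this makes sense if
no negative powers of zero occur. -/
def monomialPoint {a : ℕ} (u : Fin a → N) (w : Fin a → ℕ) (σ : PointedCone ℚ (NQ N))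
    (c : Fin a → k) : AffinePoint k σ :=
  AddMonoidAlgebra.lift k k (dualMonoid σ)
    (if h : ∀ j, c j = 0 → ∀ m ∈ dualMonoid σ, 0 ≤ m (u j) then
      { toFun := fun m => monVal u w c m.toAdd
        map_one' := by simp [monVal]
        map_mul' := fun x y => by
          rw [monVal, monVal, monVal, ← Finset.prod_mul_distrib]
          refine Finset.prod_congr rfl fun j _ => ?_
          have he : (w j : ℤ) * ((Multiplicative.toAdd (x * y) : dualMonoid σ) :
              Module.Dual ℤ N) (u j) =
              w j * (x.toAdd : Module.Dual ℤ N) (u j) + w j * (y.toAdd : Module.Dual ℤ N) (u j) := by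
            rw [toAdd_mul, AddSubmonoid.coe_add, LinearMap.add_apply, mul_add]
          rw [he]
          -- At base zero, additivity of exponents fails only when nonzero exponents cancel;
          -- nonnegativity excludes this.
          by_cases hc : c j = 0
          · have hx := mul_nonneg (Int.natCast_nonneg (w j)) (h j hc _ x.toAdd.2)
            have hy := mul_nonneg (Int.natCast_nonneg (w j)) (h j hc _ y.toAdd.2)
            exact zpow_add' (by omega)
          · exact zpow_add₀ hc _ _ }
    else 1)

variable {a : ℕ} {u : Fin a → N} {w : Fin a → ℕ}

lemma monomialPoint_chi {σ : PointedCone ℚ (NQ N)} {c : Fin a → k}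
    (h : ∀ j, c j = 0 → ∀ m ∈ dualMonoid σ, 0 ≤ m (u j)) (m : dualMonoid σ) :
    monomialPoint u w σ c (chi m) = monVal u w c m := by
  rw [monomialPoint, dif_pos h, chi, AddMonoidAlgebra.lift_single]
  simp

/-- The values at `q` of the linear forms vanishing at the `p j`. -/
def linVal (p : Fin a → P1 k) (q : P1 k) (j : Fin a) : k := formVal (linForm (p j)) q

lemma linVal_eq_zero_iff {p : Fin a → P1 k} {q : P1 k} {j : Fin a} :
    linVal p q j = 0 ↔ q = p j := formVal_linForm_eq_zero_iff

variable {F : Fan N}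

open Classical in
/-- The line on which `χ^m` is the product of the `w_j ⟨m, u_j⟩`-th powers of the linear forms
vanishing at the points `p j`. -/
def stdLine (hray : ∀ i, ray (u i) ∈ F.cones) (w : Fin a → ℕ) (p : Fin a → P1 k) (q : P1 k) :
    ToricVariety k F :=
  if h : ∃ i, q = p i then
    chart ⟨ray (u h.choose), hray h.choose⟩ (monomialPoint u w (ray (u h.choose)) (linVal p q))
  else chart ⟨⊥, F.zero_mem⟩ (monomialPoint u w ⊥ (linVal p q))

variable {hray : ∀ i, ray (u i) ∈ F.cones} {p : Fin a → P1 k}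

/-- The domain of the chart of a standard line around the `i`-th boundary point. -/
def stdDomain (p : Fin a → P1 k) (i : Fin a) : Set (P1 k) := {q | ∀ j, j ≠ i → q ≠ p j}

/-- Only the `i`-th linear form can vanish on this domain, and its exponent is nonnegative for `m`
in the dual of the ray. -/
lemma monomialPoint_ray_chi {i : Fin a} {q : P1 k} (hq : q ∈ stdDomain p i)
    (m : dualMonoid (ray (u i))) :
    monomialPoint u w (ray (u i)) (linVal p q) (chi m) = monVal u w (linVal p q) m := by
  refine monomialPoint_chi (fun j hj m hm => ?_) m
  rw [linVal_eq_zero_iff] at hj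
  obtain rfl : j = i := by
    by_contra hne
    exact hq j hne hj
  exact mem_dualMonoid_ray_iff.1 hm

lemma monomialPoint_bot_chi {q : P1 k} (hq : q ∉ Set.range p)
    (m : dualMonoid (⊥ : PointedCone ℚ (NQ N))) :
    monomialPoint u w ⊥ (linVal p q) (chi m) = monVal u w (linVal p q) m :=
  monomialPoint_chi (fun j hj => absurd ⟨j, (linVal_eq_zero_iff.1 hj).symm⟩ hq) m

lemma stdLine_of_notMem {q : P1 k} (hq : q ∉ Set.range p) :
    stdLine hray w p q = chart ⟨⊥, F.zero_mem⟩ (monomialPoint u w ⊥ (linVal p q)) := by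
  rw [stdLine, dif_neg]
  rintro ⟨i, rfl⟩
  exact hq ⟨i, rfl⟩

lemma stdLine_eq_chart {i : Fin a} {q : P1 k}
    (hq : q ∈ stdDomain p i) : stdLine hray w p q =
      chart ⟨ray (u i), hray i⟩ (monomialPoint u w (ray (u i)) (linVal p q)) := by
  by_cases h : ∃ i, q = p i
  · rw [stdLine, dif_pos h]
    have hi : h.choose = i := by
      by_contra hne
      exact hq _ hne h.choose_spec
    exact (fun i' (hi' : i' = i) => by subst hi'; rfl : ∀ i', i' = i →
      (chart ⟨ray (u i'), hray i'⟩ (monomialPoint u w (ray (u i')) (linVal p q)) :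
        ToricVariety k F) =
      chart ⟨ray (u i), hray i⟩ (monomialPoint u w (ray (u i)) (linVal p q))) _ hi
  · have hq' : q ∉ Set.range p := fun ⟨i, hi⟩ => h ⟨i, hi.symm⟩
    rw [stdLine_of_notMem hq']
    -- Away from the boundary points, the point of the torus chart is viewed in the larger chart of
    -- the ray.
    rw [← chart_incl (σ := ⟨ray (u i), hray i⟩) (τ := ⟨⊥, F.zero_mem⟩) bot_le]
    congr 1
    refine coordRing_hom_ext fun m => ?_
    rw [incl_chi, monomialPoint_bot_chi hq', monomialPoint_ray_chi hq]

lemma stdLine_mem_bigTorus {q : P1 k} (hq : q ∉ Set.range p) :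
    stdLine hray w p q ∈ bigTorus k F := by
  refine mem_bigTorus_iff.2 ⟨_, stdLine_of_notMem hq, fun m => ?_⟩
  rw [monomialPoint_bot_chi hq]
  refine Finset.prod_ne_zero_iff.2 fun j _ => zpow_ne_zero _ fun h0 => hq ⟨j, ?_⟩
  exact (linVal_eq_zero_iff.1 h0).symm

lemma charVal_stdLine {q : P1 k} (hq : q ∉ Set.range p) (m : Module.Dual ℤ N) :
    charVal (stdLine hray w p q) m = monVal u w (linVal p q) m := by
  have h := stdLine_mem_bigTorus (hray := hray) (w := w) hq
  rw [stdLine_of_notMem hq] at h ⊢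
  rw [← monomialPoint_bot_chi hq ⟨m, mem_dualMonoid_bot m⟩]
  exact charVal_chart h ⟨m, mem_dualMonoid_bot m⟩

lemma mem_stdDomain (hp : Function.Injective p) (i : Fin a) : p i ∈ stdDomain p i :=
  fun _ hj h => hj (hp h).symm

lemma isZariskiOpen_stdDomain (i : Fin a) : IsZariskiOpen (stdDomain p i) := by
  have hhom : (∏ j ∈ Finset.univ.erase i, linForm (p j)).IsHomogeneous
      (∑ j ∈ Finset.univ.erase i, 1) :=
    IsHomogeneous.prod _ _ _ fun _ _ => isHomogeneous_linForm _
  have hiff : ∀ q, formVal (∏ j ∈ Finset.univ.erase i, linForm (p j)) q ≠ 0 ↔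
      q ∈ stdDomain p i := by
    intro q
    rw [formVal_prod, Finset.prod_ne_zero_iff]
    simp [stdDomain, formVal_linForm_eq_zero_iff]
  exact fun q hq => ⟨_, _, hhom, (hiff q).2 hq, fun q hq => (hiff q).1 hq⟩

lemma zpow_eq_pow_toNat_div {c : k} (e : ℤ) : c ^ e = c ^ e.toNat / c ^ (-e).toNat := by
  obtain ⟨n, rfl | rfl⟩ := e.eq_nat_or_neg
  · simp
  · simp

lemma sum_weights_eq_zero (hbal : ∑ i, w i • u i = 0) (m : Module.Dual ℤ N) :
    ∑ j, (w j : ℤ) * m (u j) = 0 := by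
  have := congrArg m hbal
  simpa using this

/-- Positive exponents form the numerator and negative ones the denominator; balancing makes their
degrees equal. The `i`-th exponent is nonnegative, so the denominator has no zero on the domain. -/
lemma isRegularOn_monVal (hbal : ∑ i, w i • u i = 0) {i : Fin a} {m : Module.Dual ℤ N}
    (hm : 0 ≤ m (u i)) : IsRegularOn (stdDomain p i) (fun q => monVal u w (linVal p q) m) := by
  intro q hq
  have hA : (∏ j, linForm (p j) ^ ((w j : ℤ) * m (u j)).toNat).IsHomogeneous
      (∑ j, 1 * ((w j : ℤ) * m (u j)).toNat) :=
    IsHomogeneous.prod _ _ _ fun _ _ => (isHomogeneous_linForm _).pow _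
  have hB : (∏ j, linForm (p j) ^ (-((w j : ℤ) * m (u j))).toNat).IsHomogeneous
      (∑ j, 1 * (-((w j : ℤ) * m (u j))).toNat) :=
    IsHomogeneous.prod _ _ _ fun _ _ => (isHomogeneous_linForm _).pow _
  have hdeg : ∑ j, 1 * (-((w j : ℤ) * m (u j))).toNat = ∑ j, 1 * ((w j : ℤ) * m (u j)).toNat := by
    zify
    rw [eq_comm, ← sub_eq_zero, ← Finset.sum_sub_distrib, ← sum_weights_eq_zero hbal m]
    refine Finset.sum_congr rfl fun j _ => ?_
    omega
  rw [hdeg] at hB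
  refine ⟨_, _, _, hA, hB, ?_, fun q _ _ => ?_⟩
  · rw [formVal_prod, Finset.prod_ne_zero_iff]
    intro j _
    rw [formVal_pow]
    by_cases hj : j = i
    · subst hj
      have : (-((w j : ℤ) * m (u j))).toNat = 0 := by
        have := mul_nonneg (Int.natCast_nonneg (w j)) hm
        omega
      simp [this]
    · exact pow_ne_zero _ fun h0 => hq j hj (formVal_linForm_eq_zero_iff.1 h0)
  · beta_reduce
    rw [formVal_prod, formVal_prod, ← Finset.prod_div_distrib, monVal]
    refine Finset.prod_congr rfl fun j _ => ?_
    rw [formVal_pow, formVal_pow, linVal, zpow_eq_pow_toNat_div]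

/-- Since `⟨m, u_i⟩ = 1`, the `i`-th factor is exactly the `w i`-th power of the linear form at `p
i`. The other factors are nonzero there, and balancing supplies the degree difference `w i`. -/
lemma hasOrderAt_stdLine (hp : Function.Injective p) (hbal : ∑ i, w i • u i = 0) {i : Fin a}
    {m : dualMonoid (ray (u i))} (hm : (m : Module.Dual ℤ N) (u i) = 1) :
    HasOrderAt (fun q => monomialPoint u w (ray (u i)) (linVal p q) (chi m)) (p i) (w i) := by
  set E : Fin a → ℤ := fun j => (w j : ℤ) * (m : Module.Dual ℤ N) (u j) with hE
  -- The `+ 1` puts every other linear form into the denominator as well. Its nonvanishing then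
  -- implies that `q` lies in the chart domain, the only place where the formula is available.
  have hA : (∏ j ∈ Finset.univ.erase i, linForm (p j) ^ ((E j).toNat + 1)).IsHomogeneous
      (∑ j ∈ Finset.univ.erase i, 1 * ((E j).toNat + 1)) :=
    IsHomogeneous.prod _ _ _ fun _ _ => (isHomogeneous_linForm _).pow _
  have hB : (∏ j ∈ Finset.univ.erase i, linForm (p j) ^ ((-E j).toNat + 1)).IsHomogeneous
      (∑ j ∈ Finset.univ.erase i, 1 * ((-E j).toNat + 1)) :=
    IsHomogeneous.prod _ _ _ fun _ _ => (isHomogeneous_linForm _).pow _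
  have hdeg : ∑ j ∈ Finset.univ.erase i, 1 * ((-E j).toNat + 1) =
      ∑ j ∈ Finset.univ.erase i, 1 * ((E j).toNat + 1) + w i := by
    have hsum := sum_weights_eq_zero hbal (m : Module.Dual ℤ N)
    rw [← Finset.add_sum_erase _ _ (Finset.mem_univ i), hm, mul_one] at hsum
    zify
    rw [← sub_eq_iff_eq_add', ← Finset.sum_sub_distrib, eq_comm, ← sub_eq_zero, ← hsum,
      sub_eq_add_neg, ← Finset.sum_neg_distrib]
    congr 1
    refine Finset.sum_congr rfl fun j _ => ?_
    simp only [hE]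
    omega
  rw [hdeg] at hB
  have hne : ∀ (n : Fin a → ℕ), formVal (∏ j ∈ Finset.univ.erase i, linForm (p j) ^ (n j + 1))
      (p i) ≠ 0 := by
    intro n
    rw [formVal_prod, Finset.prod_ne_zero_iff]
    intro j hj
    rw [formVal_pow]
    refine pow_ne_zero _ fun h0 => Finset.ne_of_mem_erase hj ?_
    exact (hp (formVal_linForm_eq_zero_iff.1 h0)).symm
  refine ⟨_, linForm (p i), _, _, isHomogeneous_linForm _, linForm_ne_zero _,
    formVal_linForm_eq_zero_iff.2 rfl, hA, hB, hne _, hne _, fun q hq => ?_⟩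
  rw [formVal_prod, Finset.prod_ne_zero_iff] at hq
  have hq' : ∀ j, j ≠ i → formVal (linForm (p j)) q ≠ 0 := by
    intro j hj h0
    have := hq j (Finset.mem_erase.2 ⟨hj, Finset.mem_univ j⟩)
    rw [formVal_pow, h0] at this
    simp at this
  have hdom : q ∈ stdDomain p i := fun j hj h =>
    hq' j hj (formVal_linForm_eq_zero_iff.2 h)
  beta_reduce
  rw [monomialPoint_ray_chi hdom, monVal, ← Finset.mul_prod_erase _ _ (Finset.mem_univ i), hm,
    mul_one, zpow_natCast, formVal_prod, formVal_prod, mul_div_assoc, ← Finset.prod_div_distrib]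
  congr 1
  refine Finset.prod_congr rfl fun j hj => ?_
  have hj' := hq' j (Finset.ne_of_mem_erase hj)
  rw [formVal_pow, formVal_pow, linVal, zpow_eq_pow_toNat_div, pow_succ, pow_succ,
    mul_div_mul_right _ _ hj']

lemma isLocalMorphism_stdLine (hbal : ∑ i, w i • u i = 0)
    (i : Fin a) : IsLocalMorphism (stdLine hray w p) (stdDomain p i) ⟨ray (u i), hray i⟩
      (fun q => monomialPoint u w (ray (u i)) (linVal p q)) where
  isOpen := isZariskiOpen_stdDomain i
  eq_chart _ hq := stdLine_eq_chart hq
  regular := isRegularOn_of_chi fun m q hq => by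
    obtain ⟨d, A, B, hA, hB, hBp, hAB⟩ := isRegularOn_monVal (p := p) hbal
      (mem_dualMonoid_ray_iff.1 m.2) q hq
    exact ⟨d, A, B, hA, hB, hBp, fun q hq hBq => by
      beta_reduce
      rw [monomialPoint_ray_chi hq]
      exact hAB q hq hBq⟩

variable [Module.Free ℤ N] [Module.Finite ℤ N]

lemma stdLine_mem_bigTorus_iff (hp : Function.Injective p) (hprim : ∀ i, IsPrimitive (u i))
    (hw : ∀ i, 0 < w i) {q : P1 k} : stdLine hray w p q ∈ bigTorus k F ↔ q ∉ Set.range p := by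
  refine ⟨?_, stdLine_mem_bigTorus⟩
  rintro h ⟨i, rfl⟩
  rw [stdLine_eq_chart (mem_stdDomain hp i)] at h
  obtain ⟨m, hm⟩ := (hprim i).exists_dual_eq_one
  have hmem : m ∈ dualMonoid (ray (u i)) := mem_dualMonoid_ray_iff.2 (by simp [hm])
  -- At `p i` the monomial with `⟨m, u_i⟩ = 1` has the value zero because `w i` is positive.
  refine chart_chi_ne_zero h ⟨m, hmem⟩ ?_
  rw [monomialPoint_ray_chi (mem_stdDomain hp i)]
  refine Finset.prod_eq_zero (Finset.mem_univ i) ?_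
  rw [linVal_eq_zero_iff.2 rfl, hm, mul_one, zpow_natCast, zero_pow (hw i).ne']

lemma exists_mem_stdDomain (ha0 : 0 < a) (hp : Function.Injective p) (q : P1 k) :
    ∃ i, q ∈ stdDomain p i := by
  by_cases hq : ∃ i, q = p i
  · obtain ⟨i, rfl⟩ := hq
    exact ⟨i, mem_stdDomain hp i⟩
  · exact ⟨⟨0, ha0⟩, fun j _ h => hq ⟨j, h⟩⟩

lemma isLineThrough_stdLine (ha0 : 0 < a) (hp : Function.Injective p)
    (hprim : ∀ i, IsPrimitive (u i)) (hw : ∀ i, 0 < w i) (hbal : ∑ i, w i • u i = 0) :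
    IsLineThrough p u w (stdLine hray w p) := by
  refine ⟨fun q => ?_, ?_, fun i => ?_⟩
  · obtain ⟨i, hi⟩ := exists_mem_stdDomain ha0 hp q
    exact ⟨_, _, _, hi, isLocalMorphism_stdLine hbal i⟩
  · ext q
    rw [Set.mem_preimage, boundary, Set.mem_compl_iff, stdLine_mem_bigTorus_iff hp hprim hw,
      not_not]
  · obtain ⟨m, hm⟩ := (hprim i).exists_dual_eq_one
    have hmem : m ∈ dualMonoid (ray (u i)) := mem_dualMonoid_ray_iff.2 (by simp [hm])
    refine ⟨hray i, ⟨⟨ray (u i), hray i⟩, le_rfl, ?_⟩, _, _, mem_stdDomain hp i,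
      isLocalMorphism_stdLine hbal i, ⟨m, hmem⟩, hm, hasOrderAt_stdLine hp hbal hm⟩
    refine ⟨_, stdLine_eq_chart (mem_stdDomain hp i), fun m => ?_⟩
    rw [forall_mem_ray_pairing_eq_zero_iff, monomialPoint_ray_chi (mem_stdDomain hp i), monVal,
      Finset.prod_ne_zero_iff]
    constructor
    · intro h
      have := h i (Finset.mem_univ i)
      rw [linVal_eq_zero_iff.2 rfl] at this
      by_contra hne
      refine this (zero_zpow _ (mul_ne_zero ?_ hne))
      exact_mod_cast (hw i).ne'
    · intro h j _
      by_cases hj : j = i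
      · subst hj
        simp [h]
      · refine zpow_ne_zero _ fun h0 => hj (hp ?_)
        exact (linVal_eq_zero_iff.1 h0).symm

theorem isLineOfType_stdLine [Infinite k] (ha0 : 0 < a) (ha : a ≤ 3) (hp : Function.Injective p)
    (hprim : ∀ i, IsPrimitive (u i)) (hw : ∀ i, 0 < w i) (hbal : ∑ i, w i • u i = 0) :
    IsLineOfType u w (stdLine hray w p) := by
  have hl := isLineThrough_stdLine (hray := hray) ha0 hp hprim hw hbal
  have hdense : ∀ V : Set (P1 k), IsZariskiOpen V → V.Nonempty →
      ∃ q ∈ V, stdLine hray w p q ∈ bigTorus k F := by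
    rintro V hV ⟨q, hq⟩
    obtain ⟨d, v, hv, hvq, hvV⟩ := hV q hq
    obtain ⟨r, hr⟩ := exists_formVal_ne_zero (hv.mul (isHomogeneous_divForm p))
      (mul_ne_zero (ne_zero_of_formVal_ne_zero hvq) (divForm_ne_zero p))
    rw [formVal_mul] at hr
    exact ⟨r, hvV r (left_ne_zero_of_mul hr), stdLine_mem_bigTorus
      (formVal_divForm_ne_zero_iff.1 (right_ne_zero_of_mul hr))⟩
  refine ⟨⟨hl.morphism, ?_, ⟨hdense, ?_⟩, ?_⟩, p, hp, hl.range_eq, hl.meets⟩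
  · obtain ⟨q, -, hq⟩ := hdense _ (isZariskiOpen_stdDomain (p := p) ⟨0, ha0⟩)
      ⟨_, mem_stdDomain hp _⟩
    refine ⟨q, p ⟨0, ha0⟩, fun h => ?_⟩
    rw [h, stdLine_mem_bigTorus_iff hp hprim hw] at hq
    exact hq ⟨_, rfl⟩
  · rintro σ hσ q ⟨τ, hστ, hq⟩
    obtain ⟨i, hi⟩ := exists_mem_stdDomain ha0 hp q
    -- In the chart of the ray every character orthogonal to `u i` is invertible, so a stratum
    -- through this point belongs to a cone on which all these characters vanish.
    refine hσ.not_ge (coneDim_le_one (hprim i) fun m hm v hv => ?_)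
    have hmem : m ∈ dualMonoid (ray (u i)) := mem_dualMonoid_ray_iff.2 hm.ge
    have hne : monomialPoint u w (ray (u i)) (linVal p q) (chi ⟨m, hmem⟩) ≠ 0 := by
      rw [monomialPoint_ray_chi hi]
      refine Finset.prod_ne_zero_iff.2 fun j _ => ?_
      by_cases hj : j = i
      · subst hj
        simp [hm]
      · exact zpow_ne_zero _ fun h0 => hi j hj (linVal_eq_zero_iff.1 h0)
    rw [stdLine_eq_chart hi] at hq
    exact (hasChar_chart (σ := ⟨ray (u i), hray i⟩) hne).eq_zero_of_mem_orbit hq (hστ hv)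
  · rw [← hl.range_eq, ← Set.image_univ]
    refine (Set.encard_image_le _ _).trans ?_
    rw [Set.encard_univ, ENat.card_eq_coe_fintype_card, Fintype.card_fin]
    exact_mod_cast ha

end StandardLine

/-! ### Maps of tori, the quotient by a primitive vector, and balanced pairs. -/

section TorusMap

variable {k : Type*} [Field k] {N N' : Type*} [AddCommGroup N] [AddCommGroup N']

lemma Torus.ext {g h : Torus k N}
    (H : ∀ m : Module.Dual ℤ N, g (Multiplicative.ofAdd m) = h (Multiplicative.ofAdd m)) : g = h :=
  DFunLike.ext (F := Multiplicative (Module.Dual ℤ N) →* kˣ) g h fun m => H m.toAdd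

lemma Torus.map_apply (f : N →ₗ[ℤ] N') (g : Torus k N) (m : Module.Dual ℤ N') :
    Torus.map k f g (Multiplicative.ofAdd m) = g (Multiplicative.ofAdd (m ∘ₗ f)) := rfl

/-- The kernel of `𝔾(N) → 𝔾(N/ℤu)`. -/
lemma Torus.map_mkQ_eq_one_iff {u : N} {g : Torus k N} :
    Torus.map k (Submodule.span ℤ {u}).mkQ g = 1 ↔
      ∀ m : Module.Dual ℤ N, m u = 0 → g (Multiplicative.ofAdd m) = 1 := by
  constructor
  · intro h m hm
    have hle : Submodule.span ℤ {u} ≤ LinearMap.ker m := by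
      rw [Submodule.span_le, Set.singleton_subset_iff]
      exact hm
    have := congrArg (fun t : Torus k (N ⧸ Submodule.span ℤ {u}) =>
      t (Multiplicative.ofAdd ((Submodule.span ℤ {u}).liftQ m hle))) h
    simpa only [Torus.map_apply, Submodule.liftQ_mkQ, Torus.one_apply] using this
  · intro h
    refine Torus.ext fun m => ?_
    rw [Torus.map_apply, Torus.one_apply]
    refine h _ ?_
    rw [LinearMap.comp_apply, Submodule.mkQ_apply,
      (Submodule.Quotient.mk_eq_zero _).2 (Submodule.mem_span_singleton_self u), map_zero]

/-- The projection `N → N/ℤu` along a primitive vector has a linear section. -/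
lemma IsPrimitive.exists_section [Module.Free ℤ N] [Module.Finite ℤ N] {u : N}
    (hu : IsPrimitive u) :
    ∃ r : (N ⧸ Submodule.span ℤ {u}) →ₗ[ℤ] N,
      (Submodule.span ℤ {u}).mkQ ∘ₗ r = LinearMap.id := by
  obtain ⟨m₀, hm₀⟩ := hu.exists_dual_eq_one
  -- The map `x ↦ x - m₀(x) u` kills `u` and changes `x` only by a multiple of `u`.
  refine ⟨(Submodule.span ℤ {u}).liftQ (LinearMap.id - m₀.smulRight u) ?_, ?_⟩
  · rw [Submodule.span_le, Set.singleton_subset_iff]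
    simp [hm₀]
  · refine Submodule.linearMap_qext _ (LinearMap.ext fun x => ?_)
    simp only [LinearMap.comp_apply, Submodule.mkQ_apply, Submodule.liftQ_apply,
      LinearMap.sub_apply, LinearMap.id_apply, LinearMap.smulRight_apply, Submodule.Quotient.mk_sub]
    rw [sub_eq_self, Submodule.Quotient.mk_eq_zero]
    exact Submodule.smul_mem _ _ (Submodule.mem_span_singleton_self u)

/-- A weighted balancing condition between two primitive vectors. -/
lemma eq_neg_of_balanced [Module.Free ℤ N] [Module.Finite ℤ N] {u : Fin 2 → N} {w : Fin 2 → ℕ}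
    (hprim : ∀ i, IsPrimitive (u i)) (hw : ∀ i, 0 < w i) (hbal : ∑ i, w i • u i = 0) :
    w 1 = w 0 ∧ u 1 = -u 0 := by
  rw [Fin.sum_univ_two] at hbal
  obtain ⟨m, hm⟩ := (hprim 0).exists_dual_eq_one
  obtain ⟨n, hn⟩ := (hprim 1).exists_dual_eq_one
  have h1 := congrArg m hbal
  have h2 := congrArg n hbal
  simp only [map_add, map_nsmul, hm, hn, map_zero, nsmul_eq_mul, mul_one] at h1 h2
  -- Pairing the balancing relation with `m` and with `n` shows that each weight divides the other.
  have hww : w 1 = w 0 := by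
    apply Nat.dvd_antisymm
    · rw [← Int.natCast_dvd_natCast]
      exact ⟨-m (u 1), by linear_combination h1⟩
    · rw [← Int.natCast_dvd_natCast]
      exact ⟨-n (u 0), by linear_combination h2⟩
  refine ⟨hww, ?_⟩
  rw [hww, ← smul_add] at hbal
  have : IsAddTorsionFree N := .of_isTorsionFree ℤ N
  have h3 := (smul_eq_zero_iff_right (hw 0).ne').1 hbal
  exact (neg_eq_of_add_eq_zero_right h3).symm

end TorusMap

/-! ### Transitive actions of commutative groups. -/

section Actions

variable {G Y : Type*} [CommGroup G] [MulAction G Y]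

/-- All points have the same stabilizer under a transitive action of a commutative group. -/
lemma IsTransitive.smul_eq_self_iff (h : IsTransitive G Y) (x y : Y) (g : G) :
    g • x = x ↔ g • y = y := by
  obtain ⟨t, rfl⟩ := h.2 x y
  rw [smul_comm, smul_left_cancel_iff]

lemma IsTransitive.isSimplyTransitive (h : IsTransitive G Y) (x : Y)
    (hx : ∀ g : G, g • x = x → g = 1) : IsSimplyTransitive G Y := by
  refine ⟨h.1, fun y z => ?_⟩
  obtain ⟨g, hg⟩ := h.2 y z
  refine ⟨g, hg, fun g' hg' => ?_⟩
  have : (g⁻¹ * g') • y = y := by rw [mul_smul, hg', ← hg, inv_smul_smul]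
  have := hx _ ((h.smul_eq_self_iff y x _).1 this)
  exact (inv_mul_eq_one.1 this).symm

end Actions

/-! ### Descent of the action to the quotient torus. -/

section QuotientAction

variable {k : Type*} [Field k] {N : Type*} [AddCommGroup N] [Module.Free ℤ N] [Module.Finite ℤ N]
  {Y : Type*} [MulAction (Torus k N) Y]

/-- A transitive action of `𝔾(N)` with stabilizer the kernel of `𝔾(N) → 𝔾(N/ℤu)` factors over a
simply transitive action of `𝔾(N/ℤu)`. -/
lemma exists_simplyTransitive_quotient_action {u : N} (hu : IsPrimitive u)
    (htrans : IsTransitive (Torus k N) Y)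
    (hstab : ∀ (g : Torus k N) (x : Y), g • x = x ↔
      ∀ m : Module.Dual ℤ N, m u = 0 → g (Multiplicative.ofAdd m) = 1) :
    ∃ _ : MulAction (Torus k (N ⧸ Submodule.span ℤ {u})) Y,
      (∀ (g : Torus k N) (x : Y), g • x = Torus.map k (Submodule.span ℤ {u}).mkQ g • x) ∧
      IsSimplyTransitive (Torus k (N ⧸ Submodule.span ℤ {u})) Y := by
  obtain ⟨r, hr⟩ := hu.exists_section
  let π := Torus.map k (Submodule.span ℤ {u}).mkQ
  have hπ : ∀ h, π (Torus.map k r h) = h := fun h => Torus.ext fun m => by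
    rw [Torus.map_apply, Torus.map_apply, LinearMap.comp_assoc, hr, LinearMap.comp_id]
  have hker : ∀ (g g' : Torus k N) (x : Y), g • x = g' • x ↔ π g = π g' := by
    intro g g' x
    rw [← inv_smul_eq_iff, smul_smul, hstab, ← Torus.map_mkQ_eq_one_iff, map_mul, map_inv,
      inv_mul_eq_one, eq_comm]
  -- The quotient torus acts through the section `r`. By `hker` the action of an element of `𝔾(N)`
  -- depends only on its image under `π`, so the choice of `r` does not matter.
  let act : MulAction (Torus k (N ⧸ Submodule.span ℤ {u})) Y :=
    MulAction.compHom Y (Torus.map k r)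
  have hact : ∀ (h : Torus k (N ⧸ Submodule.span ℤ {u})) (x : Y),
      h • x = Torus.map k r h • x := fun _ _ => rfl
  refine ⟨act, fun g x => ?_, htrans.1, fun x y => ?_⟩
  · rw [hact, hker, hπ]
  · obtain ⟨g, hg⟩ := htrans.2 x y
    refine ⟨π g, ?_, fun h hh => ?_⟩
    · beta_reduce
      rw [hact, ← hg, hker, hπ]
    · beta_reduce at hh
      rw [hact, ← hg, hker, hπ] at hh
      exact hh

end QuotientAction

/-! ### Transitivity on classes of lines, and their stabilizers. -/

section LineSpaces

variable {k : Type*} [Field k] {N : Type*} [AddCommGroup N] {F : Fan N} {a : ℕ} {u : Fin a → N}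
  {w : Fin a → ℕ}

/-- The class of a line. -/
def LineSpace.mk {φ : P1 k → ToricVariety k F} (h : IsLineOfType u w φ) : LineSpace k F u w :=
  Quotient.mk (lineSetoid k F u w) ⟨φ, h⟩

lemma LineSpace.smul_mk_eq_mk_iff {φ φ' : P1 k → ToricVariety k F} (h : IsLineOfType u w φ)
    (h' : IsLineOfType u w φ') (g : Torus k N) :
    g • LineSpace.mk h = LineSpace.mk h' ↔
      ∃ α : Equiv.Perm (P1 k), IsP1Automorphism α ∧ ∀ q, φ' q = g • φ (α q) := by
  refine (Quotient.eq (r := lineSetoid k F u w)).trans ?_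
  exact ⟨fun ⟨α, hα, he⟩ => ⟨α, hα, fun q => congrFun he q⟩,
    fun ⟨α, hα, he⟩ => ⟨α, hα, funext he⟩⟩

lemma IsLineOfType.exists_isLineThrough {φ : P1 k → ToricVariety k F} (h : IsLineOfType u w φ) :
    ∃ p : Fin a → P1 k, Function.Injective p ∧ IsLineThrough p u w φ := by
  obtain ⟨p, hp, hr, hm⟩ := h.hasType
  exact ⟨p, hp, h.isLine.morphism, hr, hm⟩

/-- A reparametrization gives both lines the same boundary points, labelled compatibly with their
divisors and weights; then proportionality applies. -/
lemma exists_smul_lineSpace_eq [IsAlgClosed k] (ha : a = 2 ∨ a = 3) (x y : LineSpace k F u w) :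
    ∃ g : Torus k N, g • x = y := by
  obtain ⟨⟨φ, h⟩, rfl⟩ := Quotient.exists_rep x
  obtain ⟨⟨φ', h'⟩, rfl⟩ := Quotient.exists_rep y
  obtain ⟨p, hp, hl⟩ := h.exists_isLineThrough
  obtain ⟨p', hp', hl'⟩ := h'.exists_isLineThrough
  obtain ⟨e, he⟩ : ∃ e : (Fin 2 → k) ≃ₗ[k] (Fin 2 → k), ∀ i, e • p' i = p i := by
    rcases ha with rfl | rfl
    · exact exists_smul_eq_of_two hp hp'
    · exact exists_smul_eq_of_three hp hp'
  obtain rfl : (fun i => e • p' i) = p := funext he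
  obtain ⟨g, hg⟩ := hl.comp_smul.exists_smul_eq hl'
  exact ⟨g, (LineSpace.smul_mk_eq_mk_iff h h' g).2
    ⟨_, isP1Automorphism_smul e, fun q => hg q⟩⟩

variable [Module.Free ℤ N] [Module.Finite ℤ N]

/-- A torus element that fixes the class of a line with three boundary points is trivial. -/
lemma eq_one_of_smul_stdLine_eq [IsAlgClosed k] [CharZero k] {u : Fin 3 → N} {w : Fin 3 → ℕ}
    {hray : ∀ i, ray (u i) ∈ F.cones} (hprim : ∀ i, IsPrimitive (u i)) (hw : ∀ i, 0 < w i)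
    (h : IsLineOfType u w (stdLine hray w (stdPt k))) {g : Torus k N}
    (hg : g • LineSpace.mk h = LineSpace.mk h) : g = 1 := by
  obtain ⟨α, hα, he⟩ := (LineSpace.smul_mk_eq_mk_iff h h g).1 hg
  -- The torus preserves the boundary, so `α` permutes the three points. It is not claimed to fix
  -- each of them, since the pairs `(u_i, w_i)` may coincide.
  have hperm : ∀ q, q ∈ Set.range (stdPt k) ↔ α q ∈ Set.range (stdPt k) := by
    intro q
    rw [← not_iff_not, ← stdLine_mem_bigTorus_iff (hray := hray) stdPt_injective hprim hw,
      ← stdLine_mem_bigTorus_iff (hray := hray) stdPt_injective hprim hw, he q]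
    exact smul_mem_orbit_iff g
  have hs : ∀ i, ∃ j, stdPt k j = α (stdPt k i) := fun i => (hperm _).1 ⟨i, rfl⟩
  choose s hs using hs
  have hsinj : Function.Injective s := fun i j hij =>
    stdPt_injective (α.injective (by rw [← hs, ← hs, hij]))
  obtain ⟨e, hest, q, heq, hq⟩ := exists_fixed_point_of_perm (k := k) hsinj
  have hαq : α q = q := by
    rw [hα.eq_smul (e := e) fun i => by rw [← hs, hest], heq]
  have hfix := he q
  rw [hαq] at hfix
  have hb := stdLine_mem_bigTorus (hray := hray) (w := w) hq
  refine Torus.ext fun m => Units.ext ?_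
  have h1 := charVal_smul hb g m
  rw [← hfix] at h1
  exact (mul_eq_right₀ (charVal_ne_zero hb m)).1 h1.symm

variable (k) in
/-- The points `0` and `∞`. -/
def stdPair : Fin 2 → P1 k := fun i => stdPt k (![0, 2] i)

lemma stdPair_injective : Function.Injective (stdPair k) := by
  refine stdPt_injective.comp ?_
  decide

lemma affPt_notMem_range_stdPair {t : k} (ht : t ≠ 0) : affPt t ∉ Set.range (stdPair k) := by
  rintro ⟨i, hi⟩
  fin_cases i
  · exact ht (affPt_injective hi).symm
  · exact affPt_ne_infty t hi.symm

/-- The quotient of the linear forms vanishing at `0` and `∞` is a coordinate. -/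
lemma exists_linVal_stdPair_div : ∃ c : k, c ≠ 0 ∧ ∀ t : k,
    linVal (stdPair k) (affPt t) 0 / linVal (stdPair k) (affPt t) 1 = c * t := by
  have h0 : dehom₀ (linForm (stdPair k 0)) =
      Polynomial.C ((stdPair k 0).rep 0) - Polynomial.C ((stdPair k 0).rep 1) * Polynomial.X := by
    simp [dehom₀, linForm]
  have h1 : dehom₀ (linForm (stdPair k 1)) =
      Polynomial.C ((stdPair k 1).rep 0) - Polynomial.C ((stdPair k 1).rep 1) * Polynomial.X := by
    simp [dehom₀, linForm]
  have r1 : (stdPair k 1).rep 1 = 0 := rep_one_eq_zero_iff.2 rfl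
  have r0 : (stdPair k 0).rep 0 = 0 := by
    have : formVal (linForm (stdPair k 0)) (affPt 0) = 0 := formVal_linForm_eq_zero_iff.2 rfl
    by_contra hne
    refine (formVal_affPt_ne_zero_iff (isHomogeneous_linForm (stdPair k 0)) (t := 0)).2 ?_ this
    rw [h0]
    simpa using hne
  have n0 := vec_ne_zero_iff.1 (stdPair k 0).rep_nonzero
  have n1 := vec_ne_zero_iff.1 (stdPair k 1).rep_nonzero
  rw [r0] at n0
  rw [r1] at n1
  refine ⟨-(stdPair k 0).rep 1 / (stdPair k 1).rep 0, div_ne_zero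
    (neg_ne_zero.2 (n0.resolve_left (by simp))) (n1.resolve_right (by simp)), fun t => ?_⟩
  rw [linVal, linVal, formVal_div_affPt (isHomogeneous_linForm _) (isHomogeneous_linForm _), h0, h1,
    r0, r1]
  simp only [Polynomial.eval_sub, Polynomial.eval_mul, Polynomial.eval_C, Polynomial.eval_X,
    zero_sub, zero_mul, sub_zero]
  ring

/-- The two vectors are opposite and the weights equal, so only the ratio of the two linear forms
enters. -/
lemma monVal_of_balanced {u : Fin 2 → N} {w : Fin 2 → ℕ} (hprim : ∀ i, IsPrimitive (u i))
    (hw : ∀ i, 0 < w i) (hbal : ∑ i, w i • u i = 0) (c : Fin 2 → k) (m : Module.Dual ℤ N) :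
    monVal u w c m = (c 0 / c 1) ^ ((w 0 : ℤ) * m (u 0)) := by
  obtain ⟨hw1, hu1⟩ := eq_neg_of_balanced hprim hw hbal
  rw [monVal, Fin.prod_univ_two, hw1, hu1, map_neg, mul_neg, zpow_neg, div_zpow, div_eq_mul_inv]

/-- The torus elements that fix the class of a line with two boundary points. -/
lemma smul_stdLine_eq_iff [IsAlgClosed k] {u : Fin 2 → N} {w : Fin 2 → ℕ}
    {hray : ∀ i, ray (u i) ∈ F.cones} (hprim : ∀ i, IsPrimitive (u i)) (hw : ∀ i, 0 < w i)
    (hbal : ∑ i, w i • u i = 0) (h : IsLineOfType u w (stdLine hray w (stdPair k)))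
    {g : Torus k N} : g • LineSpace.mk h = LineSpace.mk h ↔
      ∀ m : Module.Dual ℤ N, m (u 0) = 0 → g (Multiplicative.ofAdd m) = 1 := by
  have hval : ∀ {q : P1 k}, q ∉ Set.range (stdPair k) → ∀ m : Module.Dual ℤ N,
      charVal (stdLine hray w (stdPair k) q) m =
        (linVal (stdPair k) q 0 / linVal (stdPair k) q 1) ^ ((w 0 : ℤ) * m (u 0)) := by
    intro q hq m
    rw [charVal_stdLine hq, monVal_of_balanced hprim hw hbal]
  have h1 : affPt (1 : k) ∉ Set.range (stdPair k) := affPt_notMem_range_stdPair one_ne_zero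
  constructor
  · intro hg m hm
    obtain ⟨α, hα, he⟩ := (LineSpace.smul_mk_eq_mk_iff h h g).1 hg
    have hb := stdLine_mem_bigTorus (hray := hray) (w := w) h1
    have hb' := hb
    rw [he] at hb'
    have hb'' := (smul_mem_orbit_iff g).1 hb'
    have hα1 := (stdLine_mem_bigTorus_iff (hray := hray) stdPair_injective hprim hw).1 hb''
    have e1 := congrArg (fun x => charVal x m) (he (affPt 1))
    -- A character orthogonal to `u 0` equals `1` along the line off the boundary points, whatever
    -- `α` is, so one point suffices to read off `g`.
    simp only [charVal_smul hb'', hval h1, hval hα1, hm, mul_zero, zpow_zero, mul_one] at e1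
    exact Units.ext e1.symm
  · intro hg
    obtain ⟨m₀, hm₀⟩ := (hprim 0).exists_dual_eq_one
    -- An element trivial on `u_0^⊥` is determined by its value at `m₀`. Scaling the coordinate by
    -- `μ` multiplies `χ^m₀` by `μ ^ w 0`, so `μ` is chosen as a root of that value.
    obtain ⟨μ, hμ⟩ := IsAlgClosed.exists_pow_nat_eq (g (Multiplicative.ofAdd m₀) : k) (hw 0)
    have hμ0 : μ ≠ 0 := by
      rintro rfl
      rw [zero_pow (hw 0).ne'] at hμ
      exact Units.ne_zero _ hμ.symm
    have hgm : ∀ m : Module.Dual ℤ N,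
        (g (Multiplicative.ofAdd m) : k) = μ ^ ((w 0 : ℤ) * m (u 0)) := by
      intro m
      have hm : m = (m - m (u 0) • m₀) + m (u 0) • m₀ := by simp
      have h2 := hg (m - m (u 0) • m₀) (by simp [hm₀])
      conv_lhs => rw [hm]
      rw [ofAdd_add, map_mul, h2, one_mul, ofAdd_zsmul, map_zpow, Units.val_zpow_eq_zpow_val, ← hμ,
        zpow_mul, zpow_natCast]
    let e := mobius μ 0 0 1 (by simpa using hμ0)
    have he : ∀ v hv w hw, cross (e v) w = 0 →
        e • Projectivization.mk k v hv = Projectivization.mk k w hw :=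
      fun v hv w hw => (ToricLines.smul_mk_eq_mk_iff e hv hw).2
    have hep : (fun i => e • stdPair k i) = stdPair k := by
      funext i
      refine he _ _ _ _ ?_
      rw [mobius_apply]
      fin_cases i <;> simp [cross, stdVec]
    have hea : e • affPt (1 : k) = affPt μ := by
      refine he _ _ _ _ ?_
      rw [mobius_apply]
      simp [cross]
    have hl : IsLineThrough (stdPair k) u w (stdLine hray w (stdPair k)) :=
      isLineThrough_stdLine (by norm_num) stdPair_injective hprim hw hbal
    -- The scaled line has the same boundary data, hence is a torus translate of the original one.
    -- It remains to identify the translating element at the single point `1`, which avoids a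
    -- comparison at the boundary points.
    obtain ⟨g', hg'⟩ := hl.exists_smul_eq (IsLineThrough.comp_smul
      (p := stdPair k) (e := e) (by rw [hep]; exact hl))
    have hgg : g = g' := by
      refine Torus.ext fun m => Units.ext ?_
      have h2 := congrArg (fun x => charVal x m) (hg' (affPt 1))
      obtain ⟨c, hc, hcv⟩ := exists_linVal_stdPair_div (k := k)
      simp only [hea, charVal_smul (stdLine_mem_bigTorus (hray := hray) (w := w) h1), hval h1,
        hval (affPt_notMem_range_stdPair hμ0), hcv] at h2
      rw [mul_zpow, mul_one, mul_comm] at h2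
      rw [hgm]
      exact mul_right_cancel₀ (zpow_ne_zero _ hc) h2
    have hinv : g⁻¹ • LineSpace.mk h = LineSpace.mk h := by
      refine (LineSpace.smul_mk_eq_mk_iff h h g⁻¹).2 ⟨_, isP1Automorphism_smul e, fun q => ?_⟩
      rw [MulAction.toPerm_apply, hg', hgg, inv_smul_smul]
    rw [inv_smul_eq_iff] at hinv
    exact hinv.symm

end LineSpaces

end ToricLines

end

theorem mainTheorem12 {k : Type*} [Field k] [IsAlgClosed k] [CharZero k]
    {N : Type*} [AddCommGroup N] [Module.Free ℤ N] [Module.Finite ℤ N]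
    (F : ToricLines.Fan N) {a : ℕ} (ha : a = 2 ∨ a = 3)
    (u : Fin a → N) (w : Fin a → ℕ)
    (hprim : ∀ i, ToricLines.IsPrimitive (u i))
    (hray : ∀ i, ToricLines.ray (u i) ∈ F.cones)
    (hw : ∀ i, 0 < w i)
    (hbal : ∑ i, w i • u i = 0) :
    ToricLines.IsTransitive (ToricLines.Torus k N) (ToricLines.LineSpace k F u w) ∧
    (a = 3 →
      ToricLines.IsSimplyTransitive (ToricLines.Torus k N) (ToricLines.LineSpace k F u w)) ∧
    (a = 2 →
      (∀ i j, Submodule.span ℤ {u i} = Submodule.span ℤ {u j}) ∧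
      ∀ i, ∃ _ : MulAction (ToricLines.Torus k (N ⧸ Submodule.span ℤ {u i}))
          (ToricLines.LineSpace k F u w),
        (∀ (g : ToricLines.Torus k N) (x : ToricLines.LineSpace k F u w),
          g • x = ToricLines.Torus.map k (Submodule.span ℤ {u i}).mkQ g • x) ∧
        ToricLines.IsSimplyTransitive (ToricLines.Torus k (N ⧸ Submodule.span ℤ {u i}))
          (ToricLines.LineSpace k F u w)) := by
  have : Infinite k := IsAlgClosed.instInfinite
  have hne : Nonempty (ToricLines.LineSpace k F u w) := by
    rcases ha with rfl | rfl
    · exact ⟨.mk (ToricLines.isLineOfType_stdLine (hray := hray) (by norm_num) (by norm_num)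
        ToricLines.stdPair_injective hprim hw hbal)⟩
    · exact ⟨.mk (ToricLines.isLineOfType_stdLine (hray := hray) (by norm_num) (by norm_num)
        ToricLines.stdPt_injective hprim hw hbal)⟩
  have htrans : ToricLines.IsTransitive (ToricLines.Torus k N) (ToricLines.LineSpace k F u w) :=
    ⟨hne, ToricLines.exists_smul_lineSpace_eq ha⟩
  refine ⟨htrans, ?_, ?_⟩
  · rintro rfl
    exact htrans.isSimplyTransitive _ fun g hg =>
      ToricLines.eq_one_of_smul_stdLine_eq hprim hw (ToricLines.isLineOfType_stdLine (hray := hray)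
        (by norm_num) le_rfl ToricLines.stdPt_injective hprim hw hbal) hg
  · rintro rfl
    have hspan : ∀ i, Submodule.span ℤ {u i} = Submodule.span ℤ {u 0} := by
      refine Fin.forall_fin_two.2 ⟨rfl, ?_⟩
      rw [(ToricLines.eq_neg_of_balanced hprim hw hbal).2, ← Set.neg_singleton,
        Submodule.span_neg]
    refine ⟨fun i j => (hspan i).trans (hspan j).symm, fun i => ?_⟩
    rw [hspan i]
    exact ToricLines.exists_simplyTransitive_quotient_action (hprim 0) htrans fun g x =>
      (htrans.smul_eq_self_iff x _ g).trans (ToricLines.smul_stdLine_eq_iff hprim hw hbal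
        (ToricLines.isLineOfType_stdLine (hray := hray) (by norm_num) (by norm_num)
          ToricLines.stdPair_injective hprim hw hbal))
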